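/- **Setting.** Let $d\in\{1,2,\dots\}$ and $H\in(0,1)$. For $\beta<0$, $\rho\in[1,\infty]$ and bounded measurable $g\colon\mathbb R^d\to\mathbb R^d$ put $\|g\|_{\mathcal B^\beta_\rho}:=\sup_{a\in(0,1]}a^{-\beta/2}\|p_a*g\|_{L_\rho(\mathbb R^d)}$, where $p_a$ is the density of $N(0,a\,\mathrm{Id})$ on $\mathbb R^d$. Let $(\mathcal F_t)_{t\in[0,1]}$ be a filtration on a probability space $(\Omega,\mathcal F,\mathbb P)$, and write $\mathbb E^s=\mathbb E[\,\cdot\,|\mathcal F_s]$. Let $Y\colon[0,1]\times\Omega\to\mathbb R^d$ be a (jointly) measurable adapted process with $\mathbb E|Y_t|<\infty$ for all $t$, and put $Y_{s,t}:=Y_t-\mathbb E^sY_t$. Let $\kappa\ge0$ and $K(\beta,\rho)\ge0$ ($\beta<0$, $\rho\in[1,\infty]$) be constants. Assume: 1. for all $0\le s\le t\le1$, $Y_{s,t}$ is independent of $\mathcal F_s$; 2. for all $0\le s<u\le t\le1$, $\mathbb E^uY_{s,t}$ has a density $p_{s,u,t}$ with respect to the Lebesgue measure and $$\|p_{s,u,t}\|_{L_\infty(\mathbb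 R^d)}\le\kappa\bigl((u-s)^{-Hd}+((t-s)^{2H}-(t-u)^{2H})^{-d/2}\bigr);$$ 3. for all $\beta<0$, $\rho\in[1,\infty]$, bounded measurable $g\colon\mathbb R^d\to\mathbb R^d$ and $0\le s<t\le1$, $$\|\mathbb E\,g(Y_{s,t}+\cdot)\|_{L_\rho(\mathbb R^d)}\le K(\beta,\rho)\,\|g\|_{\mathcal B^\beta_\rho}\,(t-s)^{\beta H}.$$ **Statement.** Let $m\in[2,\infty)$, and let $p,q\in[1,\infty)$ satisfy $\frac{1-H}{q}+\frac{Hd}{p}<1-H$. There exist $C>0$ and $\gamma\in(0,1)$, depending only on $H,d,p,q,m,\kappa,K$, such that the following holds for every $(\Omega,\mathcal F,\mathbb P)$, $(\mathcal F_t)$ and $Y$ as above, every $x\in\mathbb R^d$, every bounded measurable $f\colon[0,1]\times\mathbb R^d\to\mathbb R^d$ with $f\in L_q([0,1],L_p(\mathbb R^d))$, and every process $\psi$ adapted to $(\mathcal F_t)$ such that almost surely $$\psi_t=\int_0^tf_r(x+\psi_r+Y_r)\,dr\quad\text{for all }t\in[0,1].$$ For all $0\le s\le t\le1$, $$\bigl\|[\psi]_{1\text{-var};[s,t]}\bigr\|_{L_m(\Omega)}\le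 C\bigl(\|f\|_{L_q([s,t],L_p(\mathbb R^d))}+\|f\|^q_{L_q([s,t],L_p(\mathbb R^d))}\bigr)(t-s)^{1-H-\frac{Hd}{p}-\frac{1-H}{q}},$$ and for all $r>0$, $$\mathbb P\bigl(\|\psi\|_{\mathcal C^\gamma([0,1])}\ge r\bigr)\le C\bigl(1+\|f\|^q_{L_q([0,1],L_p(\mathbb R^d))}\bigr)^m r^{-m}.$$ Here $[\psi]_{1\text{-var};[s,t]}$ is the supremum over partitions $s=t_0\le\dots\le t_n=t$ of $\sum_i|\psi_{t_{i+1}}-\psi_{t_i}|$, $\|f\|_{L_q([s,t],L_p(\mathbb R^d))}=\bigl(\int_s^t\|f_r\|^q_{L_p(\mathbb R^d)}dr\bigr)^{1/q}$, and $\|g\|_{\mathcal C^\gamma([0,1])}=\sup_{t\in[0,1]}|g_t|+\sup_{0\le s<t\le1}\frac{|g_t-g_s|}{(t-s)^\gamma}$. -/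

import Mathlib

open MeasureTheory ProbabilityTheory
open scoped NNReal ENNReal

noncomputable section

namespace SingularDrift

/-- Euclidean space `ℝ^d`. -/
abbrev E (d : ℕ) : Type := EuclideanSpace ℝ (Fin d)

/-- The centred Gaussian density on `ℝ^d` with covariance `a • Id`. -/
def heatKernel (d : ℕ) (a : ℝ) (x : E d) : ℝ :=
  (2 * Real.pi * a) ^ (-(d : ℝ) / 2) * Real.exp (-‖x‖ ^ 2 / (2 * a))

/-- The norm of the Besov space `B^β_{ρ,∞}(ℝ^d)` of negative regularity `β < 0`, in its heat
kernel form `sup_{a ∈ (0,1]} a^{-β/2} ‖p_a * g‖_{L_ρ}`. -/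
def besovNorm {d : ℕ} (β : ℝ) (ρ : ℝ≥0∞) (g : E d → E d) : ℝ≥0∞ :=
  ⨆ a ∈ Set.Ioc (0 : ℝ) 1, ENNReal.ofReal (a ^ (-β / 2)) *
    eLpNorm (fun x : E d => ∫ y : E d, heatKernel d a (x - y) • g y) ρ volume

/-- `Y_{s,t} = Y_t - 𝔼[Y_t | ℱ_s]`. -/
def innovation {d : ℕ} {Ω : Type*} [mΩ : MeasurableSpace Ω] (P : Measure Ω)
    (ℱ : Filtration ℝ mΩ) (Y : ℝ → Ω → E d) (s t : ℝ) : Ω → E d :=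
  fun ω => Y t ω - (P[Y t | ℱ s]) ω

/-- The assumption on the noise. Times range over `[0,1]`; only `ℱ t` and `Y t` with `t ∈ [0,1]`
enter. The constant `κ` multiplies the density bound, and `K β ρ` is the constant of the smoothing
bound. The degenerate times (`u = s` in `density`, `t = s` in `smoothing`), at which the
right-hand sides are infinite, are left out. -/
structure NoiseAssumption {d : ℕ} {Ω : Type*} [mΩ : MeasurableSpace Ω] (P : Measure Ω)
    (ℱ : Filtration ℝ mΩ) (H : ℝ) (κ : ℝ≥0) (K : ℝ → ℝ≥0∞ → ℝ≥0)
    (Y : ℝ → Ω → E d) : Prop where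
  indep : ∀ s t : ℝ, 0 ≤ s → s ≤ t → t ≤ 1 →
    Indep (MeasurableSpace.comap (innovation P ℱ Y s t) inferInstance) (ℱ s) P
  density : ∀ s u t : ℝ, 0 ≤ s → s < u → u ≤ t → t ≤ 1 →
    HasPDF (P[innovation P ℱ Y s t | ℱ u]) P volume ∧
    essSup (pdf (P[innovation P ℱ Y s t | ℱ u]) P volume) volume ≤
      κ * ENNReal.ofReal ((u - s) ^ (-(H * d)) +
        ((t - s) ^ (2 * H) - (t - u) ^ (2 * H)) ^ (-(d : ℝ) / 2))
  smoothing : ∀ (β : ℝ) (ρ : ℝ≥0∞), β < 0 → 1 ≤ ρ →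
    ∀ g : E d → E d, Measurable g → (∃ M : ℝ, ∀ x, ‖g x‖ ≤ M) →
    ∀ s t : ℝ, 0 ≤ s → s < t → t ≤ 1 →
    eLpNorm (fun x : E d => ∫ ω, g (innovation P ℱ Y s t ω + x) ∂P) ρ volume ≤
      K β ρ * besovNorm β ρ g * ENNReal.ofReal ((t - s) ^ (β * H))

/-- The norm of `L_q([s,t], L_p(ℝ^d))`. -/
def mixedNorm {d : ℕ} (p q : ℝ) (s t : ℝ) (f : ℝ → E d → E d) : ℝ≥0∞ :=
  (∫⁻ r in Set.Icc s t, (eLpNorm (f r) (ENNReal.ofReal p) volume) ^ q) ^ (1 / q)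

/-- `ψ` solves `ψ_t = ∫_0^t f_r(x + ψ_r + Y_r) dr` for all `t ∈ [0,1]`, almost surely; the integral
is a Lebesgue integral. -/
def IsSolution {d : ℕ} {Ω : Type*} [MeasurableSpace Ω] (P : Measure Ω)
    (x : E d) (f : ℝ → E d → E d) (Y ψ : ℝ → Ω → E d) : Prop :=
  ∀ᵐ ω ∂P,
    IntegrableOn (fun r => f r (x + ψ r ω + Y r ω)) (Set.Icc 0 1) volume ∧
    ∀ t ∈ Set.Icc (0 : ℝ) 1, ψ t ω = ∫ r in (0 : ℝ)..t, f r (x + ψ r ω + Y r ω)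

/-- The norm of the Hölder space `C^γ([0,1], ℝ^d)` (infinite off the space). -/
def holderNorm {d : ℕ} (γ : ℝ) (g : ℝ → E d) : ℝ≥0∞ :=
  (⨆ t ∈ Set.Icc (0 : ℝ) 1, ‖g t‖ₑ) +
  ⨆ s ∈ Set.Icc (0 : ℝ) 1, ⨆ t ∈ Set.Icc (0 : ℝ) 1, ⨆ _ : s < t,
    ‖g t - g s‖ₑ / ENNReal.ofReal ((t - s) ^ γ)

end SingularDrift

end

/-!
Let `φ = x + ψ`. Freezing `φ` over a time step, the expectation of `|f_r| (φ + Y_r)` given the past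
is an average of `|f_r|` over the law of an innovation, because innovations are independent of the
past; the smoothing property of the noise bounds such averages by the `L_p`-norm of `f_r` through
the heat kernel estimate `L_p → L_∞`. Sewing over dyadic partitions controls the error of freezing
`φ`, and bounds the expectation of `A = ∫ |f_r| (φ + Y_r) dr` over an event of the past by
`N + N (𝔼 A) ^ θ` for some `θ < 1`, where `N` comes from the mixed norm of `f`. The increments of
`ψ` are dominated by the integral `A` itself, and `𝔼 A` is finite since `f` is bounded, so that
`𝔼 A` is absorbed and only the mixed norm of `f` remains. Khasminskii's argument turns this bound
on conditional first moments into a bound on all moments, which is the estimate of the variation;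
the tail of the Hölder norm then follows from the moments of the dyadic increments and Markov's
inequality.
-/

noncomputable section

namespace SingularDrift

open Set Filter
open scoped Topology BoundedContinuousFunction

/-! ### The heat kernel -/

section HeatKernel

variable {d : ℕ} {a : ℝ}

lemma heatKernel_nonneg (ha : 0 < a) (x : E d) : 0 ≤ heatKernel d a x := by
  unfold heatKernel; positivity

lemma continuous_heatKernel (a : ℝ) : Continuous (heatKernel d a) := by
  unfold heatKernel; fun_prop

lemma heatKernel_le (ha : 0 < a) (x : E d) :
    heatKernel d a x ≤ (2 * Real.pi * a) ^ (-(d : ℝ) / 2) := by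
  refine mul_le_of_le_one_right (by positivity) (Real.exp_le_one_iff.2 ?_)
  exact div_nonpos_of_nonpos_of_nonneg (by simp) (by positivity)

lemma integral_heatKernel (ha : 0 < a) : ∫ x : E d, heatKernel d a x = 1 := by
  have gaussian := GaussianFourier.integral_rexp_neg_mul_sq_norm (V := E d) (b := 1 / (2 * a))
    (by positivity)
  have exponent : ∀ x : E d, -‖x‖ ^ 2 / (2 * a) = -(1 / (2 * a)) * ‖x‖ ^ 2 := fun x => by ring
  have base : Real.pi / (1 / (2 * a)) = 2 * Real.pi * a := by field_simp
  simp_rw [heatKernel, exponent]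
  rw [integral_const_mul, gaussian, finrank_euclideanSpace_fin, base,
    ← Real.rpow_add (by positivity), neg_div, neg_add_cancel, Real.rpow_zero]

lemma integrable_heatKernel (ha : 0 < a) : Integrable (heatKernel d a) :=
  .of_integral_ne_zero (by simp [integral_heatKernel ha])

lemma lintegral_heatKernel_sub (ha : 0 < a) (x : E d) :
    ∫⁻ y : E d, ENNReal.ofReal (heatKernel d a (x - y)) = 1 := by
  rw [lintegral_sub_left_eq_self (fun y : E d => ENNReal.ofReal (heatKernel d a y)) x,
    ← ofReal_integral_eq_lintegral_ofReal (integrable_heatKernel ha)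
      (ae_of_all _ (heatKernel_nonneg ha)), integral_heatKernel ha, ENNReal.ofReal_one]

lemma measurable_ofReal_heatKernel_sub (a : ℝ) (x : E d) :
    Measurable fun y : E d => ENNReal.ofReal (heatKernel d a (x - y)) :=
  ((continuous_heatKernel a).comp (by fun_prop)).measurable.ennreal_ofReal

lemma exp_sub_exp_le {u v : ℝ} (huv : u ≤ v) :
    Real.exp (-u ^ 2 / 2) - Real.exp (-v ^ 2 / 2) ≤
      2 * min 1 (v - u) * Real.exp (-u ^ 2 / 4) := by
  have square : Real.exp (-u ^ 2 / 2) = Real.exp (-u ^ 2 / 4) * Real.exp (-u ^ 2 / 4) := by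
    rw [← Real.exp_add]; congr 1; ring
  have le_one : Real.exp (-u ^ 2 / 4) ≤ 1 := Real.exp_le_one_iff.2 (by nlinarith [sq_nonneg u])
  have pos := Real.exp_pos (-u ^ 2 / 4)
  rcases le_total 1 (v - u) with far | near
  · rw [min_eq_left far]
    nlinarith [Real.exp_pos (-v ^ 2 / 2)]
  obtain ⟨δ, rfl⟩ : ∃ δ, v = u + δ := ⟨v - u, by ring⟩
  rw [add_sub_cancel_left] at near ⊢
  rw [min_eq_right near]
  have hδ : 0 ≤ δ := by linarith
  have factor : Real.exp (-(u + δ) ^ 2 / 2) =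
      Real.exp (-u ^ 2 / 2) * Real.exp (-(δ * (2 * u + δ) / 2)) := by
    rw [← Real.exp_add]; congr 1; ring
  have one_sub_le := Real.add_one_le_exp (-(δ * (2 * u + δ) / 2))
  have exp_mul_le : Real.exp (-u ^ 2 / 4) * u ≤ 1 := by
    have cancel : Real.exp (-u ^ 2 / 4) * Real.exp (u ^ 2 / 4) = 1 := by
      rw [← Real.exp_add, neg_div, neg_add_cancel, Real.exp_zero]
    have le_exp : u ≤ Real.exp (u ^ 2 / 4) := by
      nlinarith [Real.add_one_le_exp (u ^ 2 / 4), sq_nonneg (u / 2 - 1)]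
    nlinarith
  have linear : Real.exp (-u ^ 2 / 4) * (δ * (2 * u + δ) / 2) ≤ 2 * δ := by
    have := mul_le_mul_of_nonneg_right exp_mul_le hδ
    have := mul_le_mul le_one (mul_le_mul near le_rfl hδ zero_le_one) (by positivity) zero_le_one
    nlinarith
  calc Real.exp (-u ^ 2 / 2) - Real.exp (-(u + δ) ^ 2 / 2)
      = Real.exp (-u ^ 2 / 2) * (1 - Real.exp (-(δ * (2 * u + δ) / 2))) := by rw [factor]; ring
    _ ≤ Real.exp (-u ^ 2 / 2) * (δ * (2 * u + δ) / 2) := by gcongr; linarith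
    _ = Real.exp (-u ^ 2 / 4) * (Real.exp (-u ^ 2 / 4) * (δ * (2 * u + δ) / 2)) := by
        rw [square]; ring
    _ ≤ Real.exp (-u ^ 2 / 4) * (2 * δ) := by gcongr
    _ = 2 * δ * Real.exp (-u ^ 2 / 4) := by ring

lemma min_one_le_rpow {z θ : ℝ} (hz : 0 ≤ z) (hθ0 : 0 ≤ θ) (hθ1 : θ ≤ 1) : min 1 z ≤ z ^ θ := by
  rcases le_total 1 z with h | h
  · exact (min_le_left _ _).trans (Real.one_le_rpow h hθ0)
  · refine (min_le_right _ _).trans ?_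
    simpa using Real.rpow_le_rpow_of_exponent_ge' hz h hθ0 hθ1

lemma abs_exp_sub_exp_le {u v θ : ℝ} (hu : 0 ≤ u) (hv : 0 ≤ v) (hθ0 : 0 ≤ θ) (hθ1 : θ ≤ 1) :
    |Real.exp (-u ^ 2 / 2) - Real.exp (-v ^ 2 / 2)| ≤
      2 * |u - v| ^ θ * (Real.exp (-u ^ 2 / 4) + Real.exp (-v ^ 2 / 4)) := by
  wlog huv : u ≤ v generalizing u v
  · rw [abs_sub_comm, abs_sub_comm u v, add_comm]
    exact this hv hu (le_of_not_ge huv)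
  have anti : Real.exp (-v ^ 2 / 2) ≤ Real.exp (-u ^ 2 / 2) := by
    apply Real.exp_le_exp.2; nlinarith
  rw [abs_of_nonneg (sub_nonneg.2 anti), abs_sub_comm, abs_of_nonneg (sub_nonneg.2 huv)]
  refine (exp_sub_exp_le huv).trans ?_
  have := min_one_le_rpow (sub_nonneg.2 huv) hθ0 hθ1
  gcongr
  exact le_add_of_nonneg_right (Real.exp_pos _).le

lemma abs_heatKernel_sub_le (ha : 0 < a) {θ : ℝ} (hθ0 : 0 ≤ θ) (hθ1 : θ ≤ 1) (x h : E d) :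
    |heatKernel d a (x + h) - heatKernel d a x| ≤
      2 * 2 ^ ((d : ℝ) / 2) * ‖h‖ ^ θ * a ^ (-θ / 2) *
        (heatKernel d (2 * a) (x + h) + heatKernel d (2 * a) x) := by
  have hs : 0 < √a := Real.sqrt_pos.2 ha
  have rescale : ∀ z : E d, -‖z‖ ^ 2 / (2 * a) = -(‖z‖ / √a) ^ 2 / 2 := fun z => by
    rw [div_pow, Real.sq_sqrt ha.le]; field_simp
  have rescale' : ∀ z : E d, -‖z‖ ^ 2 / (2 * (2 * a)) = -(‖z‖ / √a) ^ 2 / 4 := fun z => by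
    rw [div_pow, Real.sq_sqrt ha.le]; field_simp; norm_num
  have normalization : (2 * Real.pi * a) ^ (-(d : ℝ) / 2) =
      2 ^ ((d : ℝ) / 2) * (2 * Real.pi * (2 * a)) ^ (-(d : ℝ) / 2) := by
    rw [show 2 * Real.pi * (2 * a) = 2 * (2 * Real.pi * a) by ring,
      Real.mul_rpow (x := 2) (by norm_num) (by positivity), ← mul_assoc,
      ← Real.rpow_add (by norm_num)]
    simp [neg_div]
  have norm_diff : |‖x + h‖ / √a - ‖x‖ / √a| ^ θ ≤ ‖h‖ ^ θ * a ^ (-θ / 2) := by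
    have : |‖x + h‖ / √a - ‖x‖ / √a| ≤ ‖h‖ / √a := by
      rw [← sub_div, abs_div, abs_of_pos hs]
      gcongr
      simpa using abs_norm_sub_norm_le (x + h) x
    refine (Real.rpow_le_rpow (abs_nonneg _) this hθ0).trans_eq ?_
    rw [Real.div_rpow (norm_nonneg _) hs.le, Real.sqrt_eq_rpow, ← Real.rpow_mul ha.le,
      div_eq_mul_inv, ← Real.rpow_neg ha.le]
    congr 2; ring
  unfold heatKernel
  rw [rescale, rescale, rescale', rescale', normalization, ← mul_sub, abs_mul,
    abs_of_nonneg (by positivity)]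
  calc _ ≤ 2 ^ ((d : ℝ) / 2) * (2 * Real.pi * (2 * a)) ^ (-(d : ℝ) / 2) *
        (2 * (‖h‖ ^ θ * a ^ (-θ / 2)) * (Real.exp (-(‖x + h‖ / √a) ^ 2 / 4) +
          Real.exp (-(‖x‖ / √a) ^ 2 / 4))) := by
        refine mul_le_mul_of_nonneg_left (le_trans (abs_exp_sub_exp_le (θ := θ)
          (by positivity) (by positivity) hθ0 hθ1) ?_) (by positivity)
        gcongr
    _ = _ := by ring

end HeatKernel

section HeatConv

variable {d : ℕ} {a p : ℝ} {F : Type*} [NormedAddCommGroup F] {k : E d → F}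

lemma lintegral_heatKernel_mul_enorm_le (ha : 0 < a) (hp : 1 ≤ p)
    (hk : AEStronglyMeasurable k) (x : E d) :
    ∫⁻ y, ENNReal.ofReal (heatKernel d a (x - y)) * ‖k y‖ₑ ≤
      ENNReal.ofReal (a ^ (-(d / p) / 2)) * eLpNorm k (ENNReal.ofReal p) volume := by
  have hp0 : 0 < p := by linarith
  set ν : Measure (E d) := volume.withDensity fun y => ENNReal.ofReal (heatKernel d a (x - y))
    with hν
  have : IsProbabilityMeasure ν :=
    ⟨by rw [hν, withDensity_apply _ MeasurableSet.univ, Measure.restrict_univ,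
      lintegral_heatKernel_sub ha]⟩
  have ν_le : ν ≤ ENNReal.ofReal ((2 * Real.pi * a) ^ (-(d : ℝ) / 2)) • volume := by
    rw [← withDensity_const]
    exact withDensity_mono (ae_of_all _ fun y => ENNReal.ofReal_le_ofReal (heatKernel_le ha _))
  have as_norm : ∫⁻ y, ENNReal.ofReal (heatKernel d a (x - y)) * ‖k y‖ₑ = eLpNorm k 1 ν := by
    rw [eLpNorm_one_eq_lintegral_enorm, hν, lintegral_withDensity_eq_lintegral_mul₀
      (measurable_ofReal_heatKernel_sub a x).aemeasurable hk.enorm]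
    rfl
  have normalization_le : ((2 * Real.pi * a) ^ (-(d : ℝ) / 2)) ^ (1 / p) ≤ a ^ (-(d / p) / 2) := by
    have hdp : 0 ≤ (d : ℝ) / p := by positivity
    rw [← Real.rpow_mul (by positivity), Real.mul_rpow (by positivity) ha.le,
      show -(d : ℝ) / 2 * (1 / p) = -(d / p) / 2 by field_simp]
    exact mul_le_of_le_one_left (by positivity) (Real.rpow_le_one_of_one_le_of_nonpos
      (by nlinarith [Real.pi_gt_three]) (by linarith))
  calc _ = eLpNorm k 1 ν := as_norm
    _ ≤ eLpNorm k (ENNReal.ofReal p) ν :=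
        eLpNorm_le_eLpNorm_of_exponent_le (by simpa using hp)
          (hk.mono_ac (withDensity_absolutelyContinuous _ _))
    _ ≤ _ := eLpNorm_mono_measure _ ν_le
    _ ≤ _ := by
        rw [eLpNorm_smul_measure_of_ne_top ENNReal.ofReal_ne_top, smul_eq_mul, ENNReal.toReal_div,
          ENNReal.toReal_ofReal hp0.le, ENNReal.toReal_one,
          ENNReal.ofReal_rpow_of_nonneg (by positivity) (by positivity)]
        gcongr

variable [NormedSpace ℝ F]

/-- The heat semigroup `p_a * k`, applied to a function with values in a normed space. -/
def heatConv (a : ℝ) (k : E d → F) (x : E d) : F := ∫ y, heatKernel d a (x - y) • k y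

lemma enorm_heatConv_le (ha : 0 < a) (hp : 1 ≤ p) (hk : AEStronglyMeasurable k) (x : E d) :
    ‖heatConv a k x‖ₑ ≤
      ENNReal.ofReal (a ^ (-(d / p) / 2)) * eLpNorm k (ENNReal.ofReal p) volume := by
  refine (enorm_integral_le_lintegral_enorm _).trans (le_trans (lintegral_mono fun y => ?_)
    (lintegral_heatKernel_mul_enorm_le ha hp hk x))
  rw [enorm_smul, Real.enorm_of_nonneg (heatKernel_nonneg ha _)]

lemma heatConv_smul_const [CompleteSpace F] (a : ℝ) (k : E d → ℝ) (e : F) (x : E d) :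
    heatConv a (fun y => k y • e) x = heatConv a k x • e := by
  simp_rw [heatConv, smul_smul]
  exact integral_smul_const _ _

lemma integrable_heatKernel_sub_smul (ha : 0 < a) (k : E d →ᵇ F) (x : E d) :
    Integrable fun y => heatKernel d a (x - y) • k y :=
  ((integrable_heatKernel ha).comp_sub_left x).smul_bdd ‖k‖ k.continuous.aestronglyMeasurable
    (ae_of_all _ k.norm_coe_le_norm)

lemma heatConv_comp_add_right (a : ℝ) (k : E d → F) (h x : E d) :
    heatConv a (fun y => k (y + h)) x = heatConv a k (x + h) := by
  rw [heatConv, heatConv,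
    ← integral_add_right_eq_self (fun y => heatKernel d a (x + h - y) • k y) h]
  simp_rw [add_sub_add_right_eq_sub]

lemma enorm_heatConv_add_sub_le_lintegral (ha : 0 < a) {θ : ℝ} (hθ0 : 0 ≤ θ) (hθ1 : θ ≤ 1)
    (k : E d →ᵇ F) (x h : E d) :
    ‖heatConv a k (x + h) - heatConv a k x‖ₑ ≤
      ENNReal.ofReal (2 * 2 ^ ((d : ℝ) / 2) * ‖h‖ ^ θ * a ^ (-θ / 2)) *
        ((∫⁻ y, ENNReal.ofReal (heatKernel d (2 * a) (x + h - y)) * ‖k y‖ₑ) +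
          ∫⁻ y, ENNReal.ofReal (heatKernel d (2 * a) (x - y)) * ‖k y‖ₑ) := by
  have h2a : 0 < 2 * a := by positivity
  set c : ℝ := 2 * 2 ^ ((d : ℝ) / 2) * ‖h‖ ^ θ * a ^ (-θ / 2)
  have pointwise (y : E d) :
      ‖heatKernel d a (x + h - y) • k y - heatKernel d a (x - y) • k y‖ₑ ≤
        ENNReal.ofReal c * (ENNReal.ofReal (heatKernel d (2 * a) (x + h - y)) * ‖k y‖ₑ +
          ENNReal.ofReal (heatKernel d (2 * a) (x - y)) * ‖k y‖ₑ) := by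
    rw [← sub_smul, enorm_smul, ← add_mul, ← mul_assoc, add_sub_right_comm,
      ← ENNReal.ofReal_add (heatKernel_nonneg h2a _) (heatKernel_nonneg h2a _),
      ← ENNReal.ofReal_mul (by positivity), Real.enorm_eq_ofReal_abs]
    gcongr
    exact abs_heatKernel_sub_le ha hθ0 hθ1 (x - y) h
  calc _ = ‖∫ y, (heatKernel d a (x + h - y) • k y - heatKernel d a (x - y) • k y)‖ₑ := by
        rw [integral_sub (integrable_heatKernel_sub_smul ha k _)
          (integrable_heatKernel_sub_smul ha k _)]
        rfl
    _ ≤ _ := (enorm_integral_le_lintegral_enorm _).trans (lintegral_mono pointwise)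
    _ = _ := by
        rw [lintegral_const_mul' _ _ ENNReal.ofReal_ne_top, lintegral_add_left']
        exact (measurable_ofReal_heatKernel_sub _ _).aemeasurable.mul
          k.continuous.aestronglyMeasurable.enorm

/-- The constant of `enorm_heatConv_add_sub_le`. -/
def heatIncrConst (d : ℕ) : ℝ≥0∞ := ENNReal.ofReal (4 * 2 ^ ((d : ℝ) / 2))

lemma enorm_heatConv_add_sub_le (ha : 0 < a) (hp : 1 ≤ p) {θ : ℝ} (hθ0 : 0 ≤ θ) (hθ1 : θ ≤ 1)
    (k : E d →ᵇ F) (x h : E d) :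
    ‖heatConv a k (x + h) - heatConv a k x‖ₑ ≤
      heatIncrConst d * ‖h‖ₑ ^ θ * eLpNorm k (ENNReal.ofReal p) volume *
        ENNReal.ofReal (a ^ (-(d / p + θ) / 2)) := by
  have average_le (z : E d) :
      ∫⁻ y, ENNReal.ofReal (heatKernel d (2 * a) (z - y)) * ‖k y‖ₑ ≤
        ENNReal.ofReal (a ^ (-(d / p) / 2)) * eLpNorm k (ENNReal.ofReal p) volume := by
    refine (lintegral_heatKernel_mul_enorm_le (by positivity) hp
      k.continuous.aestronglyMeasurable z).trans ?_
    have hdp : 0 ≤ (d : ℝ) / p := by positivity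
    gcongr ENNReal.ofReal ?_ * _
    exact Real.rpow_le_rpow_of_nonpos ha (by linarith) (by linarith)
  calc _ ≤ _ := enorm_heatConv_add_sub_le_lintegral ha hθ0 hθ1 k x h
    _ ≤ ENNReal.ofReal (2 * 2 ^ ((d : ℝ) / 2) * ‖h‖ ^ θ * a ^ (-θ / 2)) *
          (2 * (ENNReal.ofReal (a ^ (-(d / p) / 2)) *
            eLpNorm k (ENNReal.ofReal p) volume)) := by
        gcongr
        exact (add_le_add (average_le _) (average_le _)).trans_eq (two_mul _).symm
    _ = _ := by
        rw [show -(d / p + θ) / 2 = -θ / 2 + -(d / p) / 2 by ring, Real.rpow_add ha, heatIncrConst,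
          show (4 : ℝ) = 2 * 2 by norm_num, ← ofReal_norm h,
          ENNReal.ofReal_rpow_of_nonneg (norm_nonneg _) hθ0]
        repeat rw [ENNReal.ofReal_mul (by positivity)]
        rw [ENNReal.ofReal_ofNat]
        ring

end HeatConv

/-! ### Averaging along the noise -/

/-- The properties of the noise `Y` behind the a priori estimate, for a constant `K β` in place of
`K β ∞`: `Y` is measurable, integrable and adapted, its innovations are independent of the past, and
they smooth out bounded functions in the sup norm. -/
structure RegularizingNoise {d : ℕ} {Ω : Type*} [mΩ : MeasurableSpace Ω] (P : Measure Ω)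
    (ℱ : Filtration ℝ mΩ) (H : ℝ) (K : ℝ → ℝ≥0) (Y : ℝ → Ω → E d) : Prop where
  measurable : Measurable fun z : ℝ × Ω => Y z.1 z.2
  adapted : ∀ t ∈ Icc (0 : ℝ) 1, Measurable[ℱ t] (Y t)
  integrable : ∀ t ∈ Icc (0 : ℝ) 1, Integrable (Y t) P
  indep : ∀ s t : ℝ, 0 ≤ s → s ≤ t → t ≤ 1 →
    Indep (MeasurableSpace.comap (innovation P ℱ Y s t) inferInstance) (ℱ s) P
  smoothing : ∀ β < 0, ∀ g : E d → E d, Measurable g → (∃ M : ℝ, ∀ x, ‖g x‖ ≤ M) →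
    ∀ s t : ℝ, 0 ≤ s → s < t → t ≤ 1 →
    eLpNorm (fun x => ∫ ω, g (innovation P ℱ Y s t ω + x) ∂P) ∞ volume ≤
      K β * besovNorm β ∞ g * ENNReal.ofReal ((t - s) ^ (β * H))

lemma setLIntegral_of_indep {Ω β γ : Type*} {m mΩ : MeasurableSpace Ω} {P : Measure Ω}
    [IsProbabilityMeasure P] [MeasurableSpace β] [MeasurableSpace γ] (hm : m ≤ mΩ) {Z : Ω → γ}
    (hZ : Measurable Z) (hind : Indep (MeasurableSpace.comap Z inferInstance) m P)
    {ζ : Ω → β} (hζ : Measurable[m] ζ) {B : Set Ω} (hB : MeasurableSet[m] B)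
    {Φ : β × γ → ℝ≥0∞} (hΦ : Measurable Φ) :
    ∫⁻ ω in B, Φ (ζ ω, Z ω) ∂P = ∫⁻ ω in B, ∫⁻ ω', Φ (ζ ω, Z ω') ∂P ∂P := by
  set χ : Ω → ℝ≥0∞ := B.indicator fun _ => 1
  set W : Ω → ℝ≥0∞ × β := fun ω => (χ ω, ζ ω)
  have hW_past : Measurable[m] W := ((@measurable_const _ _ _ m 1).indicator hB).prodMk hζ
  have hW : Measurable W := hW_past.mono hm le_rfl
  have hWZ : W ⟂ᵢ[P] Z := by
    rw [IndepFun_iff_Indep]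
    exact (indep_of_indep_of_le_right hind hW_past.comap_le).symm
  have hΨ : Measurable fun z : (ℝ≥0∞ × β) × γ => z.1.1 * Φ (z.1.2, z.2) := by fun_prop
  have restrict_eq (F : Ω → ℝ≥0∞) : ∫⁻ ω in B, F ω ∂P = ∫⁻ ω, χ ω * F ω ∂P := by
    rw [← lintegral_indicator (hm _ hB)]
    refine lintegral_congr fun ω => ?_
    by_cases h : ω ∈ B <;> simp [χ, h]
  rw [restrict_eq, restrict_eq]
  calc ∫⁻ ω, χ ω * Φ (ζ ω, Z ω) ∂P
      = ∫⁻ z, z.1.1 * Φ (z.1.2, z.2) ∂(P.map fun ω => (W ω, Z ω)) :=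
        (lintegral_map hΨ (hW.prodMk hZ)).symm
    _ = ∫⁻ w, ∫⁻ z, w.1 * Φ (w.2, z) ∂(P.map Z) ∂(P.map W) := by
        rw [(indepFun_iff_map_prod_eq_prod_map_map hW.aemeasurable hZ.aemeasurable).1 hWZ,
          lintegral_prod _ hΨ.aemeasurable]
    _ = ∫⁻ ω, ∫⁻ z, χ ω * Φ (ζ ω, z) ∂(P.map Z) ∂P := by
        rw [lintegral_map hΨ.lintegral_prod_right hW]
    _ = _ := by
        refine lintegral_congr fun ω => ?_
        have hΦω : Measurable fun z => Φ (ζ ω, z) := hΦ.comp measurable_prodMk_left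
        rw [lintegral_const_mul _ hΦω, lintegral_map hΦω hZ]

lemma ofReal_le_ofReal_add_enorm_sub (a b : ℝ) :
    ENNReal.ofReal a ≤ ENNReal.ofReal b + ‖a - b‖ₑ :=
  calc ENNReal.ofReal a = ENNReal.ofReal (b + (a - b)) := by rw [add_sub_cancel]
    _ ≤ ENNReal.ofReal b + ENNReal.ofReal (a - b) := ENNReal.ofReal_add_le
    _ ≤ _ := by gcongr; exact Real.ofReal_le_enorm _

section Noise

variable {d : ℕ} {Ω : Type*} [mΩ : MeasurableSpace Ω] {P : Measure Ω}
  {ℱ : Filtration ℝ mΩ} {H : ℝ} {K : ℝ → ℝ≥0} {Y : ℝ → Ω → E d}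

lemma NoiseAssumption.regularizingNoise {κ : ℝ≥0} {K : ℝ → ℝ≥0∞ → ℝ≥0}
    (hN : NoiseAssumption P ℱ H κ K Y) (hY : Measurable fun z : ℝ × Ω => Y z.1 z.2)
    (hY_adapted : ∀ t ∈ Icc (0 : ℝ) 1, Measurable[ℱ t] (Y t))
    (hY_integrable : ∀ t ∈ Icc (0 : ℝ) 1, Integrable (Y t) P) :
    RegularizingNoise P ℱ H (fun β => K β ∞) Y :=
  ⟨hY, hY_adapted, hY_integrable, hN.indep, fun β hβ => hN.smoothing β ∞ hβ le_top⟩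

lemma RegularizingNoise.measurable_apply (hN : RegularizingNoise P ℱ H K Y) (t : ℝ) :
    Measurable (Y t) :=
  hN.measurable.comp measurable_prodMk_left

lemma RegularizingNoise.measurable_innovation (hN : RegularizingNoise P ℱ H K Y) (s t : ℝ) :
    Measurable (innovation P ℱ Y s t) :=
  (hN.measurable_apply t).sub (stronglyMeasurable_condExp.mono (ℱ.le s)).measurable

lemma integrable_comp_add [IsFiniteMeasure P] {Z : Ω → E d} (hZ : Measurable Z) (k : E d →ᵇ ℝ)
    (z : E d) : Integrable (fun ω => k (Z ω + z)) P :=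
  .of_bound (k.continuous.measurable.comp (hZ.add_const z)).aestronglyMeasurable ‖k‖
    (ae_of_all _ fun _ => k.norm_coe_le_norm _)

lemma continuous_integral_comp_add [IsFiniteMeasure P] {Z : Ω → E d} (hZ : Measurable Z)
    (k : E d →ᵇ ℝ) : Continuous fun z => ∫ ω, k (Z ω + z) ∂P :=
  continuous_of_dominated (fun z => (integrable_comp_add hZ k z).aestronglyMeasurable)
    (fun _ => ae_of_all _ fun _ => k.norm_coe_le_norm _) (integrable_const _)
    (ae_of_all _ fun _ => by fun_prop)

/-- Scalar functions become vector-valued by multiplication with a fixed unit vector; continuity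
turns the essential supremum into a pointwise bound. -/
lemma RegularizingNoise.enorm_integral_comp_innovation_le [IsFiniteMeasure P]
    (hN : RegularizingNoise P ℱ H K Y) (hd : 1 ≤ d) {β : ℝ} (hβ : β < 0) (k : E d →ᵇ ℝ) {L : ℝ≥0∞}
    (hL : ∀ a ∈ Ioc (0 : ℝ) 1, ∀ x, ‖heatConv a k x‖ₑ ≤ L * ENNReal.ofReal (a ^ (β / 2)))
    {s t : ℝ} (hs : 0 ≤ s) (hst : s < t) (ht : t ≤ 1) (z : E d) :
    ‖∫ ω, k (innovation P ℱ Y s t ω + z) ∂P‖ₑ ≤ K β * L * ENNReal.ofReal ((t - s) ^ (β * H)) := by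
  set e : E d := EuclideanSpace.single (⟨0, hd⟩ : Fin d) (1 : ℝ)
  have he : ‖e‖ = 1 := by simp [e]
  have he' : ‖e‖ₑ = 1 := by rw [← ofReal_norm, he, ENNReal.ofReal_one]
  have besov_le : besovNorm β ∞ (fun y => k y • e) ≤ L := by
    refine iSup₂_le fun a ha => ?_
    have sup_le : eLpNorm (heatConv a fun y => k y • e) ∞ volume ≤
        L * ENNReal.ofReal (a ^ (β / 2)) := by
      rw [eLpNorm_exponent_top]
      refine essSup_le_of_ae_le _ (ae_of_all _ fun x => ?_)
      simp only [heatConv_smul_const, enorm_smul, he', mul_one]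
      exact hL a ha x
    refine (mul_le_mul_right sup_le _).trans_eq ?_
    rw [mul_left_comm, ← ENNReal.ofReal_mul (Real.rpow_nonneg ha.1.le _), ← Real.rpow_add ha.1,
      neg_div, neg_add_cancel, Real.rpow_zero, ENNReal.ofReal_one, mul_one]
  have sup_le := (hN.smoothing β hβ (fun y => k y • e) (by fun_prop)
    ⟨‖k‖, fun y => by simpa [norm_smul, he] using k.norm_coe_le_norm y⟩ s t hs hst ht).trans
    (mul_le_mul_left (mul_le_mul_right besov_le _) _)
  rw [eLpNorm_exponent_top] at sup_le
  refine (isClosed_le (continuous_integral_comp_add (hN.measurable_innovation s t) k).enorm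
    continuous_const).closure_subset (Measure.dense_of_ae (μ := volume) ?_ z)
  filter_upwards [ae_le_eLpNormEssSup (μ := (volume : Measure (E d)))
    (f := fun x => ∫ ω, k (innovation P ℱ Y s t ω + x) • e ∂P)] with x hx
  rw [integral_smul_const, enorm_smul, he', mul_one] at hx
  exact hx.trans sup_le

lemma setLIntegral_comp_add_congr {ξ η : Ω → E d} (g : E d → ℝ) (h : ξ =ᵐ[P] η) (r : ℝ)
    (B : Set Ω) :
    ∫⁻ ω in B, ENNReal.ofReal (g (ξ ω + Y r ω)) ∂P =
      ∫⁻ ω in B, ENNReal.ofReal (g (η ω + Y r ω)) ∂P := by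
  refine lintegral_congr_ae (ae_restrict_of_ae ?_)
  filter_upwards [h] with ω hω
  rw [hω]

section Comparison

variable [IsProbabilityMeasure P] {p θ u r : ℝ} {B : Set Ω} {ξ η : Ω → E d}

lemma RegularizingNoise.setLIntegral_comp_add (hN : RegularizingNoise P ℱ H K Y) {g : E d →ᵇ ℝ}
    (hg : 0 ≤ g) (hu : 0 ≤ u) (hur : u ≤ r) (hr : r ≤ 1) (hξ : Measurable[ℱ u] ξ)
    (hB : MeasurableSet[ℱ u] B) :
    ∫⁻ ω in B, ENNReal.ofReal (g (ξ ω + Y r ω)) ∂P =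
      ∫⁻ ω in B, ENNReal.ofReal (∫ ω', g (innovation P ℱ Y u r ω' +
        (ξ ω + (P[Y r | ℱ u]) ω)) ∂P) ∂P := by
  have hZ := hN.measurable_innovation u r
  have hζ : Measurable[ℱ u] fun ω => ξ ω + (P[Y r | ℱ u]) ω :=
    hξ.add stronglyMeasurable_condExp.measurable
  have decompose : ∀ ω, innovation P ℱ Y u r ω + (ξ ω + (P[Y r | ℱ u]) ω) = ξ ω + Y r ω :=
    fun ω => by simp only [innovation]; abel
  have averaged := setLIntegral_of_indep (ℱ.le u) hZ (hN.indep u r hu hur hr) hζ hB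
    (Φ := fun z => ENNReal.ofReal (g (z.2 + z.1))) (by fun_prop)
  simp only [decompose] at averaged
  rw [averaged]
  refine lintegral_congr fun ω => ?_
  rw [ofReal_integral_eq_lintegral_ofReal (integrable_comp_add hZ g _) (ae_of_all _ fun _ => hg _)]

lemma RegularizingNoise.setLIntegral_comp_add_le (hN : RegularizingNoise P ℱ H K Y) (hd : 1 ≤ d)
    (hp : 1 ≤ p) {g : E d →ᵇ ℝ} (hg : 0 ≤ g) (hu : 0 ≤ u) (hur : u < r) (hr : r ≤ 1)
    (hξ : AEStronglyMeasurable[ℱ u] ξ P) (hB : MeasurableSet[ℱ u] B) :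
    ∫⁻ ω in B, ENNReal.ofReal (g (ξ ω + Y r ω)) ∂P ≤
      K (-(d / p)) * eLpNorm g (ENNReal.ofReal p) volume *
        ENNReal.ofReal ((r - u) ^ (-(d / p) * H)) * P B := by
  obtain ⟨ξ', hξ', hξξ'⟩ := hξ
  rw [setLIntegral_comp_add_congr g hξξ',
    hN.setLIntegral_comp_add hg hu hur.le hr hξ'.measurable hB]
  have hdp : 0 < (d : ℝ) / p := by positivity
  refine (lintegral_mono fun ω => ?_).trans_eq (setLIntegral_const _ _)
  refine Real.ofReal_le_enorm _ |>.trans (hN.enorm_integral_comp_innovation_le hd (by linarith) g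
    (fun a ha x => ?_) hu hur hr _)
  rw [mul_comm]
  exact enorm_heatConv_le ha.1 hp g.continuous.aestronglyMeasurable x

lemma RegularizingNoise.enorm_integral_add_sub_le (hN : RegularizingNoise P ℱ H K Y) (hd : 1 ≤ d)
    (hp : 1 ≤ p) (hθ0 : 0 ≤ θ) (hθ1 : θ ≤ 1) (g : E d →ᵇ ℝ) (hu : 0 ≤ u) (hur : u < r)
    (hr : r ≤ 1) (z h : E d) :
    ‖∫ ω, g (innovation P ℱ Y u r ω + (z + h)) ∂P - ∫ ω, g (innovation P ℱ Y u r ω + z) ∂P‖ₑ ≤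
      K (-(d / p + θ)) * heatIncrConst d * eLpNorm g (ENNReal.ofReal p) volume *
        ENNReal.ofReal ((r - u) ^ (-(d / p + θ) * H)) * ‖h‖ₑ ^ θ := by
  have hZ := hN.measurable_innovation u r
  have hdp : 0 < (d : ℝ) / p := by positivity
  set translate : E d →ᵇ ℝ := g.compContinuous ⟨(· + h), by fun_prop⟩
  set increment : E d →ᵇ ℝ := translate - g
  have heatConv_increment (a : ℝ) (ha : 0 < a) (x : E d) :
      heatConv a increment x = heatConv a g (x + h) - heatConv a g x := by
    rw [← heatConv_comp_add_right]
    refine Eq.trans ?_ (integral_sub (integrable_heatKernel_sub_smul ha translate x)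
      (integrable_heatKernel_sub_smul ha g x))
    simp_rw [← smul_sub]
    rfl
  rw [← integral_sub (integrable_comp_add hZ g _) (integrable_comp_add hZ g _)]
  simp_rw [← add_assoc]
  refine (hN.enorm_integral_comp_innovation_le hd (β := -(d / p + θ)) (by linarith) increment
    (L := heatIncrConst d * ‖h‖ₑ ^ θ * eLpNorm g (ENNReal.ofReal p) volume) (fun a ha x => ?_)
    hu hur hr z).trans_eq ?_
  · rw [heatConv_increment a ha.1]
    exact enorm_heatConv_add_sub_le ha.1 hp hθ0 hθ1 g x h
  · ring

lemma RegularizingNoise.setLIntegral_comp_add_le_add (hN : RegularizingNoise P ℱ H K Y)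
    (hd : 1 ≤ d) (hp : 1 ≤ p) (hθ0 : 0 ≤ θ) (hθ1 : θ ≤ 1) {g : E d →ᵇ ℝ} (hg : 0 ≤ g)
    (hu : 0 ≤ u) (hur : u < r) (hr : r ≤ 1) (hξ : AEStronglyMeasurable[ℱ u] ξ P)
    (hη : AEStronglyMeasurable[ℱ u] η P) (hB : MeasurableSet[ℱ u] B) :
    ∫⁻ ω in B, ENNReal.ofReal (g (ξ ω + Y r ω)) ∂P ≤
      ∫⁻ ω in B, ENNReal.ofReal (g (η ω + Y r ω)) ∂P +
      K (-(d / p + θ)) * heatIncrConst d * eLpNorm g (ENNReal.ofReal p) volume *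
        ENNReal.ofReal ((r - u) ^ (-(d / p + θ) * H)) * ∫⁻ ω in B, ‖ξ ω - η ω‖ₑ ^ θ ∂P := by
  obtain ⟨ξ', hξ', hξξ'⟩ := hξ
  obtain ⟨η', hη', hηη'⟩ := hη
  have distance_congr : ∫⁻ ω in B, ‖ξ ω - η ω‖ₑ ^ θ ∂P = ∫⁻ ω in B, ‖ξ' ω - η' ω‖ₑ ^ θ ∂P := by
    refine lintegral_congr_ae (ae_restrict_of_ae ?_)
    filter_upwards [hξξ', hηη'] with ω h h'
    rw [h, h']
  have hξm := (hξ'.mono (ℱ.le u)).measurable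
  have hηm := (hη'.mono (ℱ.le u)).measurable
  have hYm : Measurable (P[Y r | ℱ u]) := (stronglyMeasurable_condExp.mono (ℱ.le u)).measurable
  have average_measurable :=
    (continuous_integral_comp_add (P := P) (hN.measurable_innovation u r) g).measurable
  rw [setLIntegral_comp_add_congr g hξξ', setLIntegral_comp_add_congr g hηη', distance_congr,
    hN.setLIntegral_comp_add hg hu hur.le hr hξ'.measurable hB,
    hN.setLIntegral_comp_add hg hu hur.le hr hη'.measurable hB, ← lintegral_const_mul _
    (by fun_prop), ← lintegral_add_left]
  swap
  · exact (average_measurable.comp (hηm.add hYm)).ennreal_ofReal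
  refine lintegral_mono fun ω => ?_
  have increment := hN.enorm_integral_add_sub_le hd hp hθ0 hθ1 g hu hur hr
    (η' ω + (P[Y r | ℱ u]) ω) (ξ' ω - η' ω)
  rw [show η' ω + (P[Y r | ℱ u]) ω + (ξ' ω - η' ω) = ξ' ω + (P[Y r | ℱ u]) ω by abel] at increment
  refine le_trans ?_ (add_le_add_right increment _)
  exact ofReal_le_ofReal_add_enorm_sub _ _

end Comparison

end Noise

/-! ### Mixed norms and time integrals -/

lemma sum_setLIntegral_Ioc (F : ℝ → ℝ≥0∞) {a : ℕ → ℝ} (ha : Monotone a) (n : ℕ) :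
    ∑ i ∈ Finset.range n, ∫⁻ r in Ioc (a i) (a (i + 1)), F r = ∫⁻ r in Ioc (a 0) (a n), F r := by
  induction n with
  | zero => simp
  | succ n ih =>
    rw [Finset.sum_range_succ, ih, ← lintegral_union measurableSet_Ioc
      (Ioc_disjoint_Ioc_of_le le_rfl), Ioc_union_Ioc_eq_Ioc (ha n.zero_le) (ha n.le_succ)]

lemma setLIntegral_Ioc_add (F : ℝ → ℝ≥0∞) {a b c : ℝ} (hab : a ≤ b) (hbc : b ≤ c) :
    (∫⁻ r in Ioc a b, F r) + ∫⁻ r in Ioc b c, F r = ∫⁻ r in Ioc a c, F r := by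
  rw [← lintegral_union measurableSet_Ioc (Ioc_disjoint_Ioc_of_le le_rfl),
    Ioc_union_Ioc_eq_Ioc hab hbc]

lemma sum_range_two_mul {M : Type*} [AddCommMonoid M] (f : ℕ → M) (n : ℕ) :
    ∑ i ∈ Finset.range (2 * n), f i = ∑ i ∈ Finset.range n, (f (2 * i) + f (2 * i + 1)) := by
  induction n with
  | zero => simp
  | succ n ih =>
    rw [Finset.sum_range_succ, ← ih, mul_add_one, Finset.sum_range_succ, Finset.sum_range_succ,
      add_assoc]

lemma sum_rpow_mul_rpow_le (x y : ℕ → ℝ≥0∞) {α β : ℝ} (hα : 0 ≤ α) (hβ : 0 ≤ β)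
    (hαβ : α + β ≤ 1) (n : ℕ) :
    ∑ i ∈ Finset.range n, x i ^ α * y i ^ β ≤
      (∑ i ∈ Finset.range n, x i) ^ α * (∑ i ∈ Finset.range n, y i) ^ β *
        (n : ℝ≥0∞) ^ (1 - α - β) := by
  have holder := ENNReal.lintegral_prod_norm_pow_le (μ := (Measure.count : Measure (Fin n)))
    (Finset.univ : Finset (Fin 3)) (f := ![fun i => x i, fun i => y i, fun _ => 1])
    (fun i _ => Measurable.aemeasurable (measurable_of_finite _)) (p := ![α, β, 1 - α - β])
    (by simp [Fin.sum_univ_three]) (by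
      intro i _
      fin_cases i <;> simp <;> linarith)
  simp only [lintegral_count, tsum_fintype, Fin.prod_univ_three, Matrix.cons_val_zero,
    Matrix.cons_val_one, Matrix.cons_val_two, Matrix.tail_cons, Matrix.head_cons,
    ENNReal.one_rpow, mul_one, Finset.sum_const, Finset.card_univ,
    Fintype.card_fin, nsmul_eq_mul] at holder
  simpa only [Finset.sum_range] using holder

lemma lintegral_rpow_le_of_le_one {Ω : Type*} [MeasurableSpace Ω] (μ : Measure Ω) {F : Ω → ℝ≥0∞}
    (hF : AEMeasurable F μ) {θ : ℝ} (hθ0 : 0 ≤ θ) (hθ1 : θ ≤ 1) :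
    ∫⁻ ω, F ω ^ θ ∂μ ≤ μ univ ^ (1 - θ) * (∫⁻ ω, F ω ∂μ) ^ θ := by
  simpa [mul_comm] using ENNReal.lintegral_mul_norm_pow_le (μ := μ) hF
    (aemeasurable_const (b := (1 : ℝ≥0∞))) hθ0 (sub_nonneg.2 hθ1) (by ring)

lemma measurable_eLpNorm_section {X Z F : Type*} [MeasurableSpace X] [MeasurableSpace Z]
    [NormedAddCommGroup F] [MeasurableSpace F] [OpensMeasurableSpace F]
    {μ : Measure Z} [SFinite μ] {g : X × Z → F} (hg : Measurable g) {p : ℝ} (hp : 0 < p) :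
    Measurable fun x => eLpNorm (fun z => g (x, z)) (ENNReal.ofReal p) μ := by
  simp_rw [eLpNorm_eq_lintegral_rpow_enorm_toReal (ENNReal.ofReal_pos.2 hp).ne'
    ENNReal.ofReal_ne_top, ENNReal.toReal_ofReal hp.le]
  exact (hg.enorm.pow_const p).lintegral_prod_right'.pow_const _

/-- The norm of `L_q((s,t], L_p(ℝ^d))` of a real function. -/
def scalarMixedNorm {d : ℕ} (p q s t : ℝ) (f : ℝ × E d → ℝ) : ℝ≥0∞ :=
  (∫⁻ r in Ioc s t, eLpNorm (fun y => f (r, y)) (ENNReal.ofReal p) volume ^ q) ^ (1 / q)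

lemma scalarMixedNorm_mono {d : ℕ} {p q a b s t : ℝ} (hq : 0 ≤ q) (f : ℝ × E d → ℝ) (hsa : s ≤ a)
    (hbt : b ≤ t) : scalarMixedNorm p q a b f ≤ scalarMixedNorm p q s t f := by
  unfold scalarMixedNorm
  gcongr

/-- The integral of the density `v` over the time interval `(a,b]`. -/
def timeIntegral {Ω : Type*} (v : ℝ → Ω → ℝ≥0∞) (a b : ℝ) (ω : Ω) : ℝ≥0∞ := ∫⁻ r in Ioc a b, v r ω

lemma timeIntegral_mono {Ω : Type*} (v : ℝ → Ω → ℝ≥0∞) {a b s t : ℝ} (hsa : s ≤ a) (hbt : b ≤ t)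
    (ω : Ω) : timeIntegral v a b ω ≤ timeIntegral v s t ω :=
  lintegral_mono_set (Ioc_subset_Ioc hsa hbt)

lemma measurable_timeIntegral {Ω : Type*} [MeasurableSpace Ω] {v : ℝ → Ω → ℝ≥0∞}
    (hv : Measurable fun z : ℝ × Ω => v z.1 z.2) (a b : ℝ) : Measurable (timeIntegral v a b) :=
  (hv.comp measurable_swap).lintegral_prod_right' (ν := volume.restrict (Ioc a b))

lemma sum_scalarMixedNorm_mul_rpow_le {d : ℕ} {Ω : Type*} [MeasurableSpace Ω] {μ : Measure Ω}
    {p q θ : ℝ} (hq : 0 ≤ q) (hθ : 0 ≤ θ) (hθq : 1 / q + θ ≤ 1) (f : ℝ × E d → ℝ)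
    {v : ℝ → Ω → ℝ≥0∞} (hv : Measurable fun z : ℝ × Ω => v z.1 z.2) {a : ℕ → ℝ} (ha : Monotone a)
    (n : ℕ) :
    ∑ i ∈ Finset.range n, scalarMixedNorm p q (a i) (a (i + 1)) f *
        (∫⁻ ω, timeIntegral v (a i) (a (i + 1)) ω ∂μ) ^ θ ≤
      scalarMixedNorm p q (a 0) (a n) f * (∫⁻ ω, timeIntegral v (a 0) (a n) ω ∂μ) ^ θ *
        (n : ℝ≥0∞) ^ (1 - 1 / q - θ) := by
  refine (sum_rpow_mul_rpow_le _ _ (by positivity) hθ hθq n).trans_eq ?_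
  rw [sum_setLIntegral_Ioc _ ha, ← lintegral_finsetSum _ fun i _ => measurable_timeIntegral hv _ _]
  simp only [timeIntegral, sum_setLIntegral_Ioc _ ha]
  rfl

/-- The constant of Hölder's inequality in time against the singular weight `(r - u) ^ (-c)`, that
is, the norm of the weight on `(u,u+1]` in the space dual to `L_q`. -/
def weightConst (q c : ℝ) : ℝ≥0 := Real.toNNReal ((1 / (1 - c * (q / (q - 1)))) ^ (1 - 1 / q))

lemma setLIntegral_Ioc_rpow {c u t : ℝ} (hc : c < 1) (hut : u ≤ t) :
    ∫⁻ r in Ioc u t, ENNReal.ofReal ((r - u) ^ (-c)) =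
      ENNReal.ofReal ((t - u) ^ (1 - c) / (1 - c)) := by
  have integrable : IntervalIntegrable (fun r : ℝ => (r - u) ^ (-c)) volume u t := by
    simpa using (intervalIntegral.intervalIntegrable_rpow' (a := 0) (b := t - u) (r := -c)
      (by linarith)).comp_sub_right u
  rw [← ofReal_integral_eq_lintegral_ofReal
    ((intervalIntegrable_iff_integrableOn_Ioc_of_le hut).1 integrable)]
  · rw [← intervalIntegral.integral_of_le hut,
      intervalIntegral.integral_comp_sub_right (fun r => r ^ (-c)) u,
      integral_rpow (Or.inl (by linarith)), sub_self, Real.zero_rpow (by linarith), sub_zero,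
      neg_add_eq_sub]
  · exact (ae_restrict_iff' measurableSet_Ioc).2
      (ae_of_all _ fun r hr => Real.rpow_nonneg (sub_nonneg.2 hr.1.le) _)

lemma setLIntegral_mul_rpow_le {q c : ℝ} (hq : 1 < q) (hc : c < 1 - 1 / q)
    {N : ℝ → ℝ≥0∞} (hN : Measurable N) {u t : ℝ} (hut : u ≤ t) :
    ∫⁻ r in Ioc u t, N r * ENNReal.ofReal ((r - u) ^ (-c)) ≤
      weightConst q c * (∫⁻ r in Ioc u t, N r ^ q) ^ (1 / q) *
        ENNReal.ofReal ((t - u) ^ (1 - 1 / q - c)) := by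
  have hq1 : 0 < q - 1 := sub_pos.2 hq
  set q' := q / (q - 1) with hq'
  have hq'pos : 0 < q' := by positivity
  have hinv : 1 / q' = 1 - 1 / q := by rw [hq']; field_simp
  have hcq : c * q' < 1 := by rwa [← hinv, lt_div_iff₀ hq'pos] at hc
  have h1c : 0 < 1 - c * q' := sub_pos.2 hcq
  have htu : 0 ≤ t - u := sub_nonneg.2 hut
  have weight_eq : ∫⁻ r in Ioc u t, ENNReal.ofReal ((r - u) ^ (-c)) ^ q' =
      ENNReal.ofReal ((t - u) ^ (1 - c * q') / (1 - c * q')) := by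
    rw [← setLIntegral_Ioc_rpow hcq hut]
    refine setLIntegral_congr_fun measurableSet_Ioc fun r hr => ?_
    have : 0 ≤ r - u := sub_nonneg.2 hr.1.le
    rw [ENNReal.ofReal_rpow_of_nonneg (by positivity) hq'pos.le, ← Real.rpow_mul this, neg_mul]
  have exponent_eq : (1 - c * q') * (1 - 1 / q) = 1 - 1 / q - c := by rw [← hinv]; field_simp
  refine (ENNReal.lintegral_mul_le_Lp_mul_Lq (volume.restrict (Ioc u t))
    (Real.HolderConjugate.conjExponent hq) hN.aemeasurable
    (g := fun r => ENNReal.ofReal ((r - u) ^ (-c))) (by fun_prop)).trans_eq ?_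
  rw [Real.conjExponent, ← hq', weight_eq,
    ENNReal.ofReal_rpow_of_nonneg (by positivity) (by positivity), mul_comm,
    div_eq_inv_mul, Real.mul_rpow (by positivity) (by positivity),
    ENNReal.ofReal_mul (by positivity), ← Real.rpow_mul htu, weightConst, ← one_div, hinv,
    exponent_eq, ENNReal.ofReal, mul_right_comm]

/-! ### Sewing along a controlled path -/

/-- The pairs `(q, θ)` for which the sewing argument runs: `θ` is a power of the increments of the
path such that an increment over time `δ` gains `δ ^ θ` in total, but costs only
`δ ^ ((d / p + θ) * H)` through the singularity of the noise, while leaving room for the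
integrability exponent `q` in time. -/
structure AdmissibleExponent (d : ℕ) (H p q θ : ℝ) : Prop where
  one_le_dim : 1 ≤ d
  one_le_p : 1 ≤ p
  one_lt_q : 1 < q
  hurst_nonneg : 0 ≤ H
  nonneg : 0 ≤ θ
  lt_one_sub : θ < 1 - 1 / q
  mul_hurst_lt : (d / p + θ) * H < θ

namespace AdmissibleExponent

variable {d : ℕ} {H p q θ : ℝ}

lemma lt_one (hθ : AdmissibleExponent d H p q θ) : θ < 1 := by
  have : 0 ≤ 1 / q := one_div_nonneg.2 (zero_le_one.trans hθ.one_lt_q.le)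
  linarith [hθ.lt_one_sub]

lemma mul_hurst_lt_one_sub (hθ : AdmissibleExponent d H p q θ) :
    (d / p + θ) * H < 1 - 1 / q :=
  hθ.mul_hurst_lt.trans hθ.lt_one_sub

lemma div_mul_hurst_le (hθ : AdmissibleExponent d H p q θ) : d / p * H ≤ (d / p + θ) * H :=
  mul_le_mul_of_nonneg_right (le_add_of_nonneg_right hθ.nonneg) hθ.hurst_nonneg

lemma div_mul_hurst_lt_one_sub (hθ : AdmissibleExponent d H p q θ) : d / p * H < 1 - 1 / q :=
  hθ.div_mul_hurst_le.trans_lt hθ.mul_hurst_lt_one_sub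

end AdmissibleExponent

/-- `f (r, φ r + Y r)` as a random density in the time variable `r`. -/
def pathDensity {d : ℕ} {Ω : Type*} (f : ℝ × E d → ℝ) (φ Y : ℝ → Ω → E d) (r : ℝ) (ω : Ω) : ℝ≥0∞ :=
  ENNReal.ofReal (f (r, φ r ω + Y r ω))

/-- The expectation of `∫ r in s..t, f (r, φ r + Y r)` on the event `B`. -/
def pathIntegral {d : ℕ} {Ω : Type*} [MeasurableSpace Ω] (P : Measure Ω) (B : Set Ω)
    (f : ℝ × E d → ℝ) (φ Y : ℝ → Ω → E d) (s t : ℝ) : ℝ≥0∞ :=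
  ∫⁻ r in Ioc s t, ∫⁻ ω in B, pathDensity f φ Y r ω ∂P

/-- A path `φ` with continuous trajectories, adapted up to null sets on `[0,1]`, whose increments
are controlled by the integral of the density `v`. -/
structure ControlledPath {d : ℕ} {Ω : Type*} [mΩ : MeasurableSpace Ω] (P : Measure Ω)
    (ℱ : Filtration ℝ mΩ) (φ : ℝ → Ω → E d) (v : ℝ → Ω → ℝ≥0∞) : Prop where
  continuous : ∀ ω, Continuous fun r => φ r ω
  measurable : ∀ r, Measurable (φ r)
  adapted : ∀ r ∈ Icc (0 : ℝ) 1, AEStronglyMeasurable[ℱ r] (φ r) P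
  measurable_density : Measurable fun z : ℝ × Ω => v z.1 z.2
  enorm_sub_le : ∀ᵐ ω ∂P, ∀ a b : ℝ, 0 ≤ a → a ≤ b → b ≤ 1 →
    ‖φ b ω - φ a ω‖ₑ ≤ timeIntegral v a b ω

/-- The constant in front of an increment of the path in `pathIntegral_const_le_add`. -/
def incrConst (d : ℕ) (K : ℝ → ℝ≥0) (H p q θ : ℝ) : ℝ≥0∞ :=
  K (-(d / p + θ)) * heatIncrConst d * weightConst q ((d / p + θ) * H)

section Sewing

variable {d : ℕ} {Ω : Type*} [mΩ : MeasurableSpace Ω] {P : Measure Ω}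
  {ℱ : Filtration ℝ mΩ} {H : ℝ} {K : ℝ → ℝ≥0} {Y φ : ℝ → Ω → E d}
  {v : ℝ → Ω → ℝ≥0∞} {p q θ s t : ℝ} {B : Set Ω}

lemma measurable_pathDensity {f : ℝ × E d → ℝ} (hf : Measurable f)
    (hφ : Measurable fun z : ℝ × Ω => φ z.1 z.2) (hY : Measurable fun z : ℝ × Ω => Y z.1 z.2) :
    Measurable fun z : ℝ × Ω => pathDensity f φ Y z.1 z.2 :=
  (hf.comp (measurable_fst.prodMk (hφ.add hY))).ennreal_ofReal

lemma ControlledPath.measurable_uncurry (hφ : ControlledPath P ℱ φ v) :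
    Measurable fun z : ℝ × Ω => φ z.1 z.2 :=
  measurable_uncurry_of_continuous_of_measurable hφ.continuous hφ.measurable

/-- The continuous function `y ↦ g (r, y)`. -/
def timeSection (g : ℝ × E d →ᵇ ℝ) (r : ℝ) : E d →ᵇ ℝ := g.compContinuous ⟨(r, ·), by fun_prop⟩

lemma coe_timeSection (g : ℝ × E d →ᵇ ℝ) (r : ℝ) : ⇑(timeSection g r) = fun y => g (r, y) := rfl

lemma ControlledPath.setLIntegral_enorm_sub_rpow_le (hφ : ControlledPath P ℱ φ v) (hθ0 : 0 ≤ θ)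
    (hθ1 : θ ≤ 1) {a u b : ℝ} (ha : 0 ≤ a) (hau : a ≤ u) (hub : u ≤ b) (hb : b ≤ 1) (B : Set Ω) :
    ∫⁻ ω in B, ‖φ u ω - φ a ω‖ₑ ^ θ ∂P ≤
      P B ^ (1 - θ) * (∫⁻ ω in B, timeIntegral v a b ω ∂P) ^ θ :=
  calc ∫⁻ ω in B, ‖φ u ω - φ a ω‖ₑ ^ θ ∂P
      ≤ ∫⁻ ω in B, timeIntegral v a b ω ^ θ ∂P := by
        refine lintegral_mono_ae (ae_restrict_of_ae ?_)
        filter_upwards [hφ.enorm_sub_le] with ω hω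
        exact ENNReal.rpow_le_rpow ((hω a u ha hau (hub.trans hb)).trans
          (timeIntegral_mono v le_rfl hub ω)) hθ0
    _ ≤ (P.restrict B) univ ^ (1 - θ) * (∫⁻ ω in B, timeIntegral v a b ω ∂P) ^ θ :=
        lintegral_rpow_le_of_le_one _
          (measurable_timeIntegral hφ.measurable_density a b).aemeasurable hθ0 hθ1
    _ = _ := by rw [Measure.restrict_apply_univ]

variable [IsProbabilityMeasure P]

lemma RegularizingNoise.pathIntegral_const_le (hN : RegularizingNoise P ℱ H K Y) (hd : 1 ≤ d)
    (hp : 1 ≤ p) (hq : 1 < q) (hc : d / p * H < 1 - 1 / q) {g : ℝ × E d →ᵇ ℝ} (hg : 0 ≤ g)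
    (hs : 0 ≤ s) (hst : s ≤ t) (ht : t ≤ 1) {ξ : Ω → E d} (hξ : AEStronglyMeasurable[ℱ s] ξ P)
    (hB : MeasurableSet[ℱ s] B) :
    pathIntegral P B g (fun _ => ξ) Y s t ≤
      K (-(d / p)) * weightConst q (d / p * H) * scalarMixedNorm p q s t g *
        (ENNReal.ofReal ((t - s) ^ (1 - 1 / q - d / p * H)) * P B) := by
  have norm_measurable := measurable_eLpNorm_section (μ := volume) g.continuous.measurable
    (zero_lt_one.trans_le hp)
  have pointwise : ∀ r ∈ Ioc s t, ∫⁻ ω in B, pathDensity g (fun _ => ξ) Y r ω ∂P ≤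
      (K (-(d / p)) * P B) * (eLpNorm (fun y => g (r, y)) (ENNReal.ofReal p) volume *
        ENNReal.ofReal ((r - s) ^ (-(d / p * H)))) := fun r hr => by
    refine (hN.setLIntegral_comp_add_le (g := timeSection g r) hd hp (fun _ => hg _) hs hr.1
      (hr.2.trans ht) hξ hB).trans_eq ?_
    rw [coe_timeSection, neg_mul]
    ring
  refine (setLIntegral_mono' measurableSet_Ioc pointwise).trans ?_
  rw [lintegral_const_mul _ (by fun_prop)]
  refine (mul_le_mul_right (setLIntegral_mul_rpow_le hq hc norm_measurable hst) _).trans_eq ?_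
  rw [scalarMixedNorm]
  ring

lemma RegularizingNoise.pathIntegral_const_le_add (hN : RegularizingNoise P ℱ H K Y)
    (hθ : AdmissibleExponent d H p q θ) {g : ℝ × E d →ᵇ ℝ} (hg : 0 ≤ g) (hs : 0 ≤ s) (hst : s ≤ t)
    (ht : t ≤ 1) {ξ η : Ω → E d} (hξ : AEStronglyMeasurable[ℱ s] ξ P)
    (hη : AEStronglyMeasurable[ℱ s] η P) (hB : MeasurableSet[ℱ s] B) :
    pathIntegral P B g (fun _ => ξ) Y s t ≤ pathIntegral P B g (fun _ => η) Y s t +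
      incrConst d K H p q θ * scalarMixedNorm p q s t g *
        ENNReal.ofReal ((t - s) ^ (1 - 1 / q - (d / p + θ) * H)) *
          ∫⁻ ω in B, ‖ξ ω - η ω‖ₑ ^ θ ∂P := by
  have norm_measurable := measurable_eLpNorm_section (μ := volume) g.continuous.measurable
    (zero_lt_one.trans_le hθ.one_le_p)
  set D : ℝ≥0∞ := K (-(d / p + θ)) * heatIncrConst d
  set I : ℝ≥0∞ := ∫⁻ ω in B, ‖ξ ω - η ω‖ₑ ^ θ ∂P
  have pointwise : ∀ r ∈ Ioc s t, ∫⁻ ω in B, pathDensity g (fun _ => ξ) Y r ω ∂P ≤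
      ∫⁻ ω in B, pathDensity g (fun _ => η) Y r ω ∂P +
      (D * I) * (eLpNorm (fun y => g (r, y)) (ENNReal.ofReal p) volume *
        ENNReal.ofReal ((r - s) ^ (-((d / p + θ) * H)))) := fun r hr => by
    refine (hN.setLIntegral_comp_add_le_add (g := timeSection g r) hθ.one_le_dim hθ.one_le_p
      hθ.nonneg hθ.lt_one.le (fun _ => hg _) hs hr.1 (hr.2.trans ht) hξ hη hB).trans_eq ?_
    simp only [coe_timeSection, neg_mul, pathDensity]
    ring
  refine (setLIntegral_mono' measurableSet_Ioc pointwise).trans ?_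
  rw [lintegral_add_right _ (by fun_prop), lintegral_const_mul _ (by fun_prop)]
  refine add_le_add_right ((mul_le_mul_right (setLIntegral_mul_rpow_le hθ.one_lt_q
    hθ.mul_hurst_lt_one_sub norm_measurable hst) _).trans_eq ?_) _
  rw [scalarMixedNorm, incrConst]
  ring

lemma RegularizingNoise.pathIntegral_split_le (hN : RegularizingNoise P ℱ H K Y)
    (hθ : AdmissibleExponent d H p q θ) (hφ : ControlledPath P ℱ φ v) {g : ℝ × E d →ᵇ ℝ}
    (hg : 0 ≤ g) {a u b : ℝ} (ha : 0 ≤ a) (hau : a ≤ u) (hub : u ≤ b) (hb : b ≤ 1)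
    (hB : MeasurableSet[ℱ a] B) :
    pathIntegral P B g (fun _ => φ a) Y a u + pathIntegral P B g (fun _ => φ u) Y u b ≤
      pathIntegral P B g (fun _ => φ a) Y a b +
      incrConst d K H p q θ * P B ^ (1 - θ) *
        ENNReal.ofReal ((b - u) ^ (1 - 1 / q - (d / p + θ) * H)) *
      (scalarMixedNorm p q a b g * (∫⁻ ω in B, timeIntegral v a b ω ∂P) ^ θ) := by
  have hφa : AEStronglyMeasurable[ℱ u] (φ a) P :=
    (hφ.adapted a ⟨ha, by linarith⟩).mono (ℱ.mono hau)
  have hφu := hφ.adapted u ⟨ha.trans hau, hub.trans hb⟩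
  calc pathIntegral P B g (fun _ => φ a) Y a u + pathIntegral P B g (fun _ => φ u) Y u b
      ≤ pathIntegral P B g (fun _ => φ a) Y a u + (pathIntegral P B g (fun _ => φ a) Y u b +
        incrConst d K H p q θ * scalarMixedNorm p q u b g *
          ENNReal.ofReal ((b - u) ^ (1 - 1 / q - (d / p + θ) * H)) *
            ∫⁻ ω in B, ‖φ u ω - φ a ω‖ₑ ^ θ ∂P) := by
        gcongr
        exact hN.pathIntegral_const_le_add hθ hg (ha.trans hau) hub hb hφu hφa (ℱ.mono hau _ hB)
    _ = pathIntegral P B g (fun _ => φ a) Y a b +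
        incrConst d K H p q θ * scalarMixedNorm p q u b g *
          ENNReal.ofReal ((b - u) ^ (1 - 1 / q - (d / p + θ) * H)) *
            ∫⁻ ω in B, ‖φ u ω - φ a ω‖ₑ ^ θ ∂P := by
        rw [← add_assoc]
        congr 1
        exact setLIntegral_Ioc_add _ hau hub
    _ ≤ pathIntegral P B g (fun _ => φ a) Y a b +
        incrConst d K H p q θ * scalarMixedNorm p q a b g *
          ENNReal.ofReal ((b - u) ^ (1 - 1 / q - (d / p + θ) * H)) *
            (P B ^ (1 - θ) * (∫⁻ ω in B, timeIntegral v a b ω ∂P) ^ θ) := by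
        gcongr
        · exact scalarMixedNorm_mono (zero_le_one.trans hθ.one_lt_q.le) _ hau le_rfl
        · exact hφ.setLIntegral_enorm_sub_rpow_le hθ.nonneg hθ.lt_one.le ha hau hub hb B
    _ = _ := by ring

end Sewing

/-- The `i`-th point of the partition of `[s,t]` into `2 ^ n` intervals of equal length. -/
def dyadicPt (s t : ℝ) (n i : ℕ) : ℝ := s + i * ((t - s) / 2 ^ n)

section Dyadic

variable {s t : ℝ}

lemma dyadicPt_mono (hst : s ≤ t) (n : ℕ) : Monotone (dyadicPt s t n) := by
  intro i j hij
  have : 0 ≤ (t - s) / 2 ^ n := div_nonneg (sub_nonneg.2 hst) (by positivity)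
  unfold dyadicPt
  gcongr

@[simp] lemma dyadicPt_zero (s t : ℝ) (n : ℕ) : dyadicPt s t n 0 = s := by simp [dyadicPt]

@[simp] lemma dyadicPt_last (s t : ℝ) (n : ℕ) : dyadicPt s t n (2 ^ n) = t := by
  simp only [dyadicPt, Nat.cast_pow, Nat.cast_ofNat]
  field_simp
  ring

lemma dyadicPt_succ_two_mul (s t : ℝ) (n i : ℕ) :
    dyadicPt s t (n + 1) (2 * i) = dyadicPt s t n i := by
  simp only [dyadicPt, pow_succ, Nat.cast_mul, Nat.cast_ofNat]
  field_simp

lemma dyadicPt_succ_sub (s t : ℝ) (n i : ℕ) :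
    dyadicPt s t n (i + 1) - dyadicPt s t n i = (t - s) / 2 ^ n := by
  simp only [dyadicPt, Nat.cast_add, Nat.cast_one]
  ring

lemma ofReal_div_two_pow_succ_rpow_le (hst : s ≤ t) {e : ℝ} (he : 0 ≤ e) (n : ℕ) :
    ENNReal.ofReal (((t - s) / 2 ^ (n + 1)) ^ e) ≤
      ENNReal.ofReal ((t - s) ^ e) * ENNReal.ofReal (2 ^ (-e)) ^ n := by
  have hts : 0 ≤ t - s := sub_nonneg.2 hst
  rw [← ENNReal.ofReal_pow (by positivity), ← ENNReal.ofReal_mul (by positivity)]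
  refine ENNReal.ofReal_le_ofReal ?_
  calc ((t - s) / 2 ^ (n + 1)) ^ e ≤ ((t - s) / 2 ^ n) ^ e := by
        gcongr
        · norm_num
        · exact n.le_succ
    _ = (t - s) ^ e * (2 ^ (-e)) ^ n := by
        rw [Real.div_rpow hts (by positivity), ← Real.rpow_natCast, ← Real.rpow_natCast,
          ← Real.rpow_mul zero_le_two, ← Real.rpow_mul zero_le_two, div_eq_mul_inv,
          ← Real.rpow_neg zero_le_two]
        ring_nf

lemma ofReal_two_rpow_pow_mul_two_pow_rpow (x : ℝ) {y : ℝ} (hy : 0 ≤ y) (n : ℕ) :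
    ENNReal.ofReal (2 ^ x) ^ n * ((2 ^ n : ℕ) : ℝ≥0∞) ^ y = ENNReal.ofReal (2 ^ (x + y)) ^ n := by
  rw [← ENNReal.ofReal_natCast, ENNReal.ofReal_rpow_of_nonneg (by positivity) hy,
    ← ENNReal.ofReal_pow (by positivity), ← ENNReal.ofReal_pow (by positivity),
    ← ENNReal.ofReal_mul (by positivity), Real.rpow_add zero_lt_two, mul_pow]
  push_cast
  rw [← Real.rpow_natCast_mul zero_le_two, mul_comm (n : ℝ), Real.rpow_mul_natCast zero_le_two]

end Dyadic

/-- The path integral with `φ` frozen at the left endpoints of the dyadic intervals of level `n`. -/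
def dyadicSum {d : ℕ} {Ω : Type*} [MeasurableSpace Ω] (P : Measure Ω) (B : Set Ω)
    (g : ℝ × E d → ℝ) (φ Y : ℝ → Ω → E d) (s t : ℝ) (n : ℕ) : ℝ≥0∞ :=
  ∑ i ∈ Finset.range (2 ^ n), pathIntegral P B g (fun _ => φ (dyadicPt s t n i)) Y
    (dyadicPt s t n i) (dyadicPt s t n (i + 1))

/-- The constant of the sewing estimate: the bound at level `0` plus the geometric series of the
refinement errors. -/
def sewingConst (d : ℕ) (K : ℝ → ℝ≥0) (H p q θ : ℝ) : ℝ≥0∞ :=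
  K (-(d / p)) * weightConst q (d / p * H) +
    incrConst d K H p q θ * (1 - ENNReal.ofReal (2 ^ (-(θ - (d / p + θ) * H))))⁻¹

lemma inv_one_sub_ofReal_two_rpow_ne_top {x : ℝ} (hx : x < 0) :
    (1 - ENNReal.ofReal (2 ^ x))⁻¹ ≠ ∞ :=
  ENNReal.inv_ne_top.2 (tsub_pos_of_lt
    (ENNReal.ofReal_lt_one.2 (Real.rpow_lt_one_of_one_lt_of_neg one_lt_two hx))).ne'

lemma sewingConst_ne_top {d : ℕ} {K : ℝ → ℝ≥0} {H p q θ : ℝ} (h : (d / p + θ) * H < θ) :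
    sewingConst d K H p q θ ≠ ∞ := by
  have series_ne_top : (1 - ENNReal.ofReal (2 ^ (-(θ - (d / p + θ) * H))))⁻¹ ≠ ∞ :=
    inv_one_sub_ofReal_two_rpow_ne_top (by linarith)
  have incrConst_ne_top : incrConst d K H p q θ ≠ ∞ :=
    ENNReal.mul_ne_top (ENNReal.mul_ne_top ENNReal.coe_ne_top ENNReal.ofReal_ne_top)
      ENNReal.coe_ne_top
  exact ENNReal.add_ne_top.2 ⟨ENNReal.mul_ne_top ENNReal.coe_ne_top ENNReal.coe_ne_top,
    ENNReal.mul_ne_top incrConst_ne_top series_ne_top⟩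

/-- The right-hand side of the sewing estimate over a time interval of length `δ`, up to the
constant and the norm of the integrand: `b` is the probability of the event, and `y` is the
expectation on this event of the density controlling the path. -/
def sewingBound (d : ℕ) (H p q θ δ : ℝ) (b y : ℝ≥0∞) : ℝ≥0∞ :=
  ENNReal.ofReal (δ ^ (1 - 1 / q - d / p * H)) * b +
    ENNReal.ofReal (δ ^ (1 - 1 / q - (d / p + θ) * H)) * b ^ (1 - θ) * y ^ θ

section DyadicSum

variable {d : ℕ} {Ω : Type*} [mΩ : MeasurableSpace Ω] {P : Measure Ω} [IsProbabilityMeasure P]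
  {ℱ : Filtration ℝ mΩ} {H : ℝ} {K : ℝ → ℝ≥0} {Y φ : ℝ → Ω → E d}
  {v : ℝ → Ω → ℝ≥0∞} {p q θ s t : ℝ} {B : Set Ω} {g : ℝ × E d →ᵇ ℝ}

lemma RegularizingNoise.pathIntegral_dyadic_split_le (hN : RegularizingNoise P ℱ H K Y)
    (hθ : AdmissibleExponent d H p q θ) (hφ : ControlledPath P ℱ φ v) (hg : 0 ≤ g) (hs : 0 ≤ s)
    (hst : s ≤ t) (ht : t ≤ 1) (hB : MeasurableSet[ℱ s] B) {n i : ℕ} (hi : i < 2 ^ n) :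
    pathIntegral P B g (fun _ => φ (dyadicPt s t (n + 1) (2 * i))) Y
        (dyadicPt s t (n + 1) (2 * i)) (dyadicPt s t (n + 1) (2 * i + 1)) +
      pathIntegral P B g (fun _ => φ (dyadicPt s t (n + 1) (2 * i + 1))) Y
        (dyadicPt s t (n + 1) (2 * i + 1)) (dyadicPt s t (n + 1) (2 * i + 1 + 1)) ≤
      pathIntegral P B g (fun _ => φ (dyadicPt s t n i)) Y
        (dyadicPt s t n i) (dyadicPt s t n (i + 1)) +
      incrConst d K H p q θ * P B ^ (1 - θ) *
        (ENNReal.ofReal ((t - s) ^ (1 - 1 / q - (d / p + θ) * H)) *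
          ENNReal.ofReal (2 ^ (-(1 - 1 / q - (d / p + θ) * H))) ^ n) *
      (scalarMixedNorm p q (dyadicPt s t n i) (dyadicPt s t n (i + 1)) g *
        (∫⁻ ω in B, timeIntegral v (dyadicPt s t n i) (dyadicPt s t n (i + 1)) ω ∂P) ^ θ) := by
  have mono := dyadicPt_mono hst n
  have mono' := dyadicPt_mono hst (n + 1)
  have right_eq : dyadicPt s t (n + 1) (2 * i + 1 + 1) = dyadicPt s t n (i + 1) :=
    dyadicPt_succ_two_mul s t n (i + 1)
  have left_eq := dyadicPt_succ_two_mul s t n i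
  have s_le : s ≤ dyadicPt s t n i := by simpa using mono i.zero_le
  have le_t : dyadicPt s t n (i + 1) ≤ t := by simpa using mono (show i + 1 ≤ 2 ^ n from hi)
  have length_eq := dyadicPt_succ_sub s t (n + 1) (2 * i + 1)
  have split := hN.pathIntegral_split_le hθ hφ hg (hs.trans s_le)
    (left_eq ▸ mono' (2 * i).le_succ) (right_eq ▸ mono' (2 * i + 1).le_succ) (le_t.trans ht)
    (ℱ.mono s_le _ hB)
  rw [right_eq] at length_eq
  rw [length_eq] at split
  rw [right_eq, left_eq]
  refine split.trans ?_
  gcongr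
  exact ofReal_div_two_pow_succ_rpow_le hst (sub_nonneg.2 hθ.mul_hurst_lt_one_sub.le) n

lemma RegularizingNoise.dyadicSum_succ_le (hN : RegularizingNoise P ℱ H K Y)
    (hθ : AdmissibleExponent d H p q θ) (hφ : ControlledPath P ℱ φ v) (hg : 0 ≤ g) (hs : 0 ≤ s)
    (hst : s ≤ t) (ht : t ≤ 1) (hB : MeasurableSet[ℱ s] B) (n : ℕ) :
    dyadicSum P B g φ Y s t (n + 1) ≤ dyadicSum P B g φ Y s t n +
      incrConst d K H p q θ * P B ^ (1 - θ) *
      (scalarMixedNorm p q s t g * (∫⁻ ω in B, timeIntegral v s t ω ∂P) ^ θ) *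
        ENNReal.ofReal ((t - s) ^ (1 - 1 / q - (d / p + θ) * H)) *
        ENNReal.ofReal (2 ^ (-(θ - (d / p + θ) * H))) ^ n := by
  have hθq : 0 ≤ 1 - 1 / q - θ := sub_nonneg.2 hθ.lt_one_sub.le
  have holder := sum_scalarMixedNorm_mul_rpow_le (μ := P.restrict B) (p := p)
    (zero_le_one.trans hθ.one_lt_q.le) hθ.nonneg (by linarith) g hφ.measurable_density
    (dyadicPt_mono hst n) (2 ^ n)
  rw [dyadicPt_zero, dyadicPt_last] at holder
  unfold dyadicSum
  rw [pow_succ 2 n, mul_comm (2 ^ n) 2, sum_range_two_mul]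
  refine (Finset.sum_le_sum fun i hi => hN.pathIntegral_dyadic_split_le hθ hφ hg hs hst ht hB
    (Finset.mem_range.1 hi)).trans ?_
  rw [Finset.sum_add_distrib, ← Finset.mul_sum]
  refine add_le_add_right ((mul_le_mul_right holder _).trans_eq ?_) _
  rw [show -(θ - (d / p + θ) * H) = -(1 - 1 / q - (d / p + θ) * H) + (1 - 1 / q - θ) by ring,
    ← ofReal_two_rpow_pow_mul_two_pow_rpow _ hθq]
  ring

lemma RegularizingNoise.dyadicSum_le (hN : RegularizingNoise P ℱ H K Y)
    (hθ : AdmissibleExponent d H p q θ) (hφ : ControlledPath P ℱ φ v) (hg : 0 ≤ g) (hs : 0 ≤ s)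
    (hst : s ≤ t) (ht : t ≤ 1) (hB : MeasurableSet[ℱ s] B) (n : ℕ) :
    dyadicSum P B g φ Y s t n ≤ sewingConst d K H p q θ * scalarMixedNorm p q s t g *
      sewingBound d H p q θ (t - s) (P B) (∫⁻ ω in B, timeIntegral v s t ω ∂P) := by
  set N := scalarMixedNorm p q s t g
  set y := ∫⁻ ω in B, timeIntegral v s t ω ∂P
  set ρ := ENNReal.ofReal (2 ^ (-(θ - (d / p + θ) * H)))
  set X := incrConst d K H p q θ * P B ^ (1 - θ) * (N * y ^ θ) *
    ENNReal.ofReal ((t - s) ^ (1 - 1 / q - (d / p + θ) * H)) with hX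
  have telescope : dyadicSum P B g φ Y s t n ≤
      dyadicSum P B g φ Y s t 0 + X * ∑ k ∈ Finset.range n, ρ ^ k := by
    induction n with
    | zero => simp
    | succ n ih =>
      refine (hN.dyadicSum_succ_le hθ hφ hg hs hst ht hB n).trans ?_
      rw [Finset.sum_range_succ, mul_add, ← add_assoc]
      exact add_le_add_left ih _
  have level_zero : dyadicSum P B g φ Y s t 0 ≤ K (-(d / p)) * weightConst q (d / p * H) * N *
      (ENNReal.ofReal ((t - s) ^ (1 - 1 / q - d / p * H)) * P B) := by
    simpa [dyadicSum, dyadicPt] using hN.pathIntegral_const_le hθ.one_le_dim hθ.one_le_p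
      hθ.one_lt_q hθ.div_mul_hurst_lt_one_sub hg hs hst ht (hφ.adapted s ⟨hs, hst.trans ht⟩) hB
  have geometric : ∑ k ∈ Finset.range n, ρ ^ k ≤ (1 - ρ)⁻¹ :=
    (ENNReal.sum_le_tsum _).trans_eq (ENNReal.tsum_geometric ρ)
  refine telescope.trans ((add_le_add level_zero (mul_le_mul_right geometric X)).trans ?_)
  have series_eq : X * (1 - ρ)⁻¹ = incrConst d K H p q θ * (1 - ρ)⁻¹ * N *
      (ENNReal.ofReal ((t - s) ^ (1 - 1 / q - (d / p + θ) * H)) * P B ^ (1 - θ) * y ^ θ) := by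
    rw [hX]
    ring
  rw [series_eq, sewingBound, mul_add]
  gcongr
  · exact le_self_add
  · exact le_add_self

end DyadicSum

/-! ### From frozen sums to bounded measurable integrands -/

/-- The left endpoint of the dyadic interval of level `n` that contains `r`; these intervals are
left-open, hence the shifted ceiling. -/
def dyadicLeft (s t : ℝ) (n : ℕ) (r : ℝ) : ℝ :=
  dyadicPt s t n (⌈(r - s) / ((t - s) / 2 ^ n)⌉₊ - 1)

section DyadicLeft

variable {s t : ℝ}

lemma measurable_dyadicLeft (s t : ℝ) (n : ℕ) : Measurable (dyadicLeft s t n) :=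
  (measurable_of_countable fun k : ℕ => dyadicPt s t n (k - 1)).comp
    (Nat.measurable_ceil.comp (by fun_prop))

lemma dyadicLeft_eq (hst : s < t) {n i : ℕ} {r : ℝ}
    (hr : r ∈ Ioc (dyadicPt s t n i) (dyadicPt s t n (i + 1))) :
    dyadicLeft s t n r = dyadicPt s t n i := by
  have length_pos : 0 < (t - s) / 2 ^ n := div_pos (sub_pos.2 hst) (by positivity)
  have ceil_eq : ⌈(r - s) / ((t - s) / 2 ^ n)⌉₊ = i + 1 := by
    rw [Nat.ceil_eq_iff i.succ_ne_zero, lt_div_iff₀ length_pos, div_le_iff₀ length_pos,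
      Nat.succ_sub_one]
    exact ⟨lt_sub_iff_add_lt'.2 hr.1, sub_le_iff_le_add'.2 hr.2⟩
  rw [dyadicLeft, ceil_eq, Nat.add_sub_cancel]

lemma abs_dyadicLeft_sub_le (hst : s < t) {r : ℝ} (hr : s < r) (n : ℕ) :
    |dyadicLeft s t n r - r| ≤ (t - s) / 2 ^ n := by
  unfold dyadicLeft dyadicPt
  set δ := (t - s) / 2 ^ n
  have δ_pos : 0 < δ := div_pos (sub_pos.2 hst) (by positivity)
  have pos : 0 < (r - s) / δ := div_pos (sub_pos.2 hr) δ_pos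
  have le_ceil := Nat.le_ceil ((r - s) / δ)
  have ceil_lt := Nat.ceil_lt_add_one pos.le
  rw [div_le_iff₀ δ_pos] at le_ceil
  rw [← sub_lt_iff_lt_add, lt_div_iff₀ δ_pos] at ceil_lt
  rw [Nat.cast_pred (Nat.ceil_pos.2 pos), abs_le]
  constructor <;> linarith

lemma tendsto_dyadicLeft (hst : s < t) {r : ℝ} (hr : s < r) :
    Tendsto (fun n => dyadicLeft s t n r) atTop (𝓝 r) := by
  rw [tendsto_iff_dist_tendsto_zero]
  refine squeeze_zero (fun _ => dist_nonneg) (fun n => abs_dyadicLeft_sub_le hst hr n) ?_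
  simpa [div_eq_mul_inv] using (tendsto_pow_atTop_nhds_zero_of_lt_one (r := (1 / 2 : ℝ))
    (by norm_num) (by norm_num)).const_mul (t - s)

end DyadicLeft

section Extension

lemma lintegral_le_of_tendsto {X : Type*} [MeasurableSpace X] {μ : Measure X} {F : ℕ → X → ℝ≥0∞}
    {f : X → ℝ≥0∞} (hF : ∀ n, Measurable (F n))
    (hlim : ∀ᵐ x ∂μ, Tendsto (fun n => F n x) atTop (𝓝 (f x)))
    {b : ℕ → ℝ≥0∞} {L : ℝ≥0∞} (hb : ∀ n, ∫⁻ x, F n x ∂μ ≤ b n) (hbL : Tendsto b atTop (𝓝 L)) :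
    ∫⁻ x, f x ∂μ ≤ L :=
  calc ∫⁻ x, f x ∂μ = ∫⁻ x, liminf (fun n => F n x) atTop ∂μ :=
        lintegral_congr_ae (hlim.mono fun _ hx => hx.liminf_eq.symm)
    _ ≤ liminf (fun n => ∫⁻ x, F n x ∂μ) atTop := lintegral_liminf_le hF
    _ ≤ liminf b atTop := liminf_le_liminf (Eventually.of_forall hb)
    _ = L := hbL.liminf_eq

lemma exists_boundedContinuous_tendsto_ae {X : Type*} [TopologicalSpace X]
    [TopologicalSpace.PseudoMetrizableSpace X] [SecondCountableTopology X] [MeasurableSpace X]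
    [BorelSpace X] (ν : Measure X) [SFinite ν]
    {f : X → ℝ} (hf : Measurable f) {M : ℝ} (hf_mem : ∀ x, f x ∈ Icc 0 M) :
    ∃ g : ℕ → X →ᵇ ℝ, (∀ n x, g n x ∈ Icc 0 M) ∧
      ∀ᵐ x ∂ν, Tendsto (fun n => g n x) atTop (𝓝 (f x)) := by
  have f_memLp : MemLp f 1 ν.toFinite :=
    MemLp.of_bound hf.aestronglyMeasurable M (ae_of_all _ fun x => by
      rw [Real.norm_of_nonneg (hf_mem x).1]
      exact (hf_mem x).2)
  choose k hk _ using fun n : ℕ => f_memLp.exists_boundedContinuous_eLpNorm_sub_le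
    ENNReal.one_ne_top (ENNReal.inv_ne_zero.2 (ENNReal.natCast_ne_top n))
  have tendsto_zero : Tendsto (fun n => eLpNorm (⇑(k n) - f) 1 ν.toFinite) atTop (𝓝 0) := by
    refine tendsto_of_tendsto_of_tendsto_of_le_of_le tendsto_const_nhds
      ENNReal.tendsto_inv_nat_nhds_zero (fun _ => zero_le) fun n => ?_
    rw [eLpNorm_sub_comm]
    exact hk n
  obtain ⟨ns, -, hns⟩ := (tendstoInMeasure_of_tendsto_eLpNorm one_ne_zero
    (fun n => (k n).continuous.aestronglyMeasurable) hf.aestronglyMeasurable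
    tendsto_zero).exists_seq_tendsto_ae
  rw [ae_toFinite] at hns
  refine ⟨fun n => BoundedContinuousFunction.const X 0 ⊔
    (BoundedContinuousFunction.const X M ⊓ k (ns n)), fun n x => ⟨le_sup_left, ?_⟩, ?_⟩
  · exact sup_le ((hf_mem x).1.trans (hf_mem x).2) inf_le_left
  · filter_upwards [hns] with x hx
    have clamp_eq : f x = 0 ⊔ (M ⊓ f x) := by
      rw [inf_eq_right.2 (hf_mem x).2, sup_eq_right.2 (hf_mem x).1]
    rw [clamp_eq]
    exact tendsto_const_nhds.sup_nhds (tendsto_const_nhds.inf_nhds hx)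

lemma tendsto_eLpNorm_of_dominated {X F : Type*} [MeasurableSpace X] [NormedAddCommGroup F]
    {μ : Measure X} {p : ℝ≥0∞} (hp : p ≠ 0) (hp_top : p ≠ ∞) {g : ℕ → X → F} {f : X → F} {h : X → ℝ}
    (hg : ∀ n, AEStronglyMeasurable (g n) μ) (hgh : ∀ n x, ‖g n x‖ ≤ h x)
    (hh : eLpNorm h p μ ≠ ∞) (hlim : ∀ᵐ x ∂μ, Tendsto (fun n => g n x) atTop (𝓝 (f x))) :
    Tendsto (fun n => eLpNorm (g n) p μ) atTop (𝓝 (eLpNorm f p μ)) := by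
  simp_rw [eLpNorm_eq_lintegral_rpow_enorm_toReal hp hp_top]
  refine (ENNReal.continuous_rpow_const.tendsto _).comp ?_
  refine tendsto_lintegral_of_dominated_convergence' (fun x => ‖h x‖ₑ ^ p.toReal)
    (fun n => (hg n).enorm.pow_const _) (fun n => ae_of_all _ fun x => ?_)
    (lintegral_rpow_enorm_lt_top_of_eLpNorm_lt_top hp hp_top hh.lt_top).ne ?_
  · exact ENNReal.rpow_le_rpow (enorm_le_iff_norm_le.2 ((hgh n x).trans (le_abs_self _)))
      ENNReal.toReal_nonneg
  · filter_upwards [hlim] with x hx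
    exact (ENNReal.continuous_rpow_const.tendsto _).comp hx.enorm

variable {d : ℕ} {p q s t : ℝ}

lemma scalarMixedNorm_mono_norm (hq : 0 ≤ q) {f g : ℝ × E d → ℝ} (hfg : ∀ z, ‖f z‖ ≤ ‖g z‖) :
    scalarMixedNorm p q s t f ≤ scalarMixedNorm p q s t g :=
  ENNReal.rpow_le_rpow (lintegral_mono fun r =>
    ENNReal.rpow_le_rpow (eLpNorm_mono fun y => hfg (r, y)) hq) (by positivity)

lemma tendsto_scalarMixedNorm_of_dominated (hp : 0 < p) (hq : 0 < q) {g : ℕ → ℝ × E d → ℝ}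
    {f : ℝ × E d → ℝ} {k : E d → ℝ} (hg : ∀ n, Measurable (g n)) (hgk : ∀ n z, ‖g n z‖ ≤ k z.2)
    (hk : eLpNorm k (ENNReal.ofReal p) volume ≠ ∞)
    (hlim : ∀ᵐ z ∂(volume.restrict (Ioc s t)).prod volume,
      Tendsto (fun n => g n z) atTop (𝓝 (f z))) :
    Tendsto (fun n => scalarMixedNorm p q s t (g n)) atTop (𝓝 (scalarMixedNorm p q s t f)) := by
  refine (ENNReal.continuous_rpow_const.tendsto _).comp ?_
  refine tendsto_lintegral_of_dominated_convergence
    (fun _ => eLpNorm k (ENNReal.ofReal p) volume ^ q)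
    (fun n => (measurable_eLpNorm_section (hg n) hp).pow_const q) (fun n => ?_) ?_ ?_
  · exact ae_of_all _ fun r => ENNReal.rpow_le_rpow
      (eLpNorm_mono fun y => (hgk n (r, y)).trans (le_abs_self _)) hq.le
  · rw [setLIntegral_const]
    exact ENNReal.mul_ne_top (ENNReal.rpow_ne_top_of_nonneg hq.le hk) measure_Ioc_lt_top.ne
  · filter_upwards [Measure.ae_ae_of_ae_prod hlim] with r hr
    exact (ENNReal.continuous_rpow_const.tendsto _).comp (tendsto_eLpNorm_of_dominated
      (ENNReal.ofReal_pos.2 hp).ne' ENNReal.ofReal_ne_top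
      (fun n => ((hg n).comp measurable_prodMk_left).aestronglyMeasurable)
      (fun n y => hgk n (r, y)) hk hr)

variable {μ : Measure (ℝ × E d)} [SFinite μ] {A : ℝ≥0∞} {f : ℝ × E d → ℝ} {M : ℝ}

lemma lintegral_mul_compactlySupported_le (hp : 0 < p) (hq : 0 < q) (hA : A ≠ ∞)
    (h : ∀ g : ℝ × E d →ᵇ ℝ, 0 ≤ g →
      ∫⁻ z, ENNReal.ofReal (g z) ∂μ ≤ A * scalarMixedNorm p q s t g)
    (hf : Measurable f) (hf_mem : ∀ z, f z ∈ Icc 0 M) {χ : C(E d, ℝ)} (hχ : HasCompactSupport χ)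
    (hχ_mem : ∀ y, χ y ∈ Icc (0 : ℝ) 1) :
    ∫⁻ z, ENNReal.ofReal (f z * χ z.2) ∂μ ≤ A * scalarMixedNorm p q s t f := by
  let ν : Measure (ℝ × E d) := μ + (volume.restrict (Ioc s t)).prod volume
  obtain ⟨k, hk_mem, hk⟩ := exists_boundedContinuous_tendsto_ae ν hf hf_mem
  let g (n : ℕ) : ℝ × E d →ᵇ ℝ :=
    k n * BoundedContinuousFunction.ofNormedAddCommGroup (fun z => χ z.2) (by fun_prop) 1
      fun z => by
        rw [Real.norm_of_nonneg (hχ_mem z.2).1]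
        exact (hχ_mem z.2).2
  have g_apply (n : ℕ) (z : ℝ × E d) : g n z = k n z * χ z.2 := rfl
  have g_nonneg (n : ℕ) : 0 ≤ g n := fun z => mul_nonneg (hk_mem n z).1 (hχ_mem z.2).1
  have g_le (n : ℕ) (z : ℝ × E d) : ‖g n z‖ ≤ M * χ z.2 := by
    rw [g_apply, Real.norm_of_nonneg (mul_nonneg (hk_mem n z).1 (hχ_mem z.2).1)]
    exact mul_le_mul_of_nonneg_right (hk_mem n z).2 (hχ_mem z.2).1
  have g_tendsto : ∀ᵐ z ∂ν, Tendsto (fun n => g n z) atTop (𝓝 (f z * χ z.2)) :=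
    hk.mono fun z hz => hz.mul_const _
  rw [ae_add_measure_iff] at g_tendsto
  have cutoff_norm_ne_top :
      eLpNorm (fun y => M * χ y) (ENNReal.ofReal p) (volume : Measure (E d)) ≠ ∞ :=
    ((χ.continuous.memLp_of_hasCompactSupport hχ).const_mul M).eLpNorm_ne_top
  have norm_tendsto := tendsto_scalarMixedNorm_of_dominated hp hq
    (fun n => (g n).continuous.measurable) g_le cutoff_norm_ne_top g_tendsto.2
  refine (lintegral_le_of_tendsto (fun n => (g n).continuous.measurable.ennreal_ofReal)
    (g_tendsto.1.mono fun z hz => ENNReal.tendsto_ofReal hz) (fun n => h (g n) (g_nonneg n))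
    (ENNReal.Tendsto.const_mul norm_tendsto (Or.inr hA))).trans ?_
  refine mul_le_mul_right (scalarMixedNorm_mono_norm hq.le fun z => ?_) _
  rw [norm_mul, Real.norm_of_nonneg (hχ_mem z.2).1]
  exact mul_le_of_le_one_right (norm_nonneg _) (hχ_mem z.2).2

lemma exists_cutoff (n : ℕ) : ∃ χ : C(E d, ℝ), HasCompactSupport χ ∧
    (∀ y, χ y ∈ Icc (0 : ℝ) 1) ∧ ∀ y, ‖y‖ ≤ n → χ y = 1 := by
  obtain ⟨χ, hχ_one, -, hχ, hχ_mem⟩ := exists_continuous_one_zero_of_isCompact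
    (isCompact_closedBall (0 : E d) n) isClosed_empty (disjoint_empty _)
  exact ⟨χ, hχ, hχ_mem, fun y hy => hχ_one (mem_closedBall_zero_iff.2 hy)⟩

lemma lintegral_le_scalarMixedNorm_of_boundedContinuous (hp : 0 < p) (hq : 0 < q) (hA : A ≠ ∞)
    (h : ∀ g : ℝ × E d →ᵇ ℝ, 0 ≤ g →
      ∫⁻ z, ENNReal.ofReal (g z) ∂μ ≤ A * scalarMixedNorm p q s t g)
    (hf : Measurable f) (hf_mem : ∀ z, f z ∈ Icc 0 M) :
    ∫⁻ z, ENNReal.ofReal (f z) ∂μ ≤ A * scalarMixedNorm p q s t f := by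
  choose χ hχ hχ_mem hχ_one using exists_cutoff (d := d)
  refine lintegral_le_of_tendsto
    (fun n => (hf.mul ((χ n).continuous.measurable.comp measurable_snd)).ennreal_ofReal)
    (ae_of_all _ fun z => ?_)
    (fun n => lintegral_mul_compactlySupported_le hp hq hA h hf hf_mem (hχ n) (hχ_mem n))
    tendsto_const_nhds
  refine tendsto_const_nhds.congr' ?_
  filter_upwards [tendsto_natCast_atTop_atTop.eventually_ge_atTop ‖z.2‖] with n hn
  rw [Pi.mul_apply, Function.comp_apply, hχ_one n z.2 hn, mul_one]

end Extension

section SewingEstimate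

variable {d : ℕ} {Ω : Type*} [mΩ : MeasurableSpace Ω] {P : Measure Ω}
  {ℱ : Filtration ℝ mΩ} {H : ℝ} {K : ℝ → ℝ≥0} {Y φ : ℝ → Ω → E d}
  {v : ℝ → Ω → ℝ≥0∞} {p q θ s t : ℝ} {B : Set Ω}

lemma dyadicSum_eq_pathIntegral (g : ℝ × E d → ℝ) (hst : s < t) (n : ℕ) :
    dyadicSum P B g φ Y s t n = pathIntegral P B g (fun r => φ (dyadicLeft s t n r)) Y s t := by
  have sum_eq := sum_setLIntegral_Ioc (fun r => ∫⁻ ω in B,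
    pathDensity g (fun r => φ (dyadicLeft s t n r)) Y r ω ∂P) (dyadicPt_mono hst.le n) (2 ^ n)
  rw [dyadicPt_zero, dyadicPt_last] at sum_eq
  rw [pathIntegral, ← sum_eq, dyadicSum]
  refine Finset.sum_congr rfl fun i _ => setLIntegral_congr_fun measurableSet_Ioc fun r hr => ?_
  simp only [pathDensity, dyadicLeft_eq hst hr]

variable [IsProbabilityMeasure P]

lemma RegularizingNoise.pathIntegral_boundedContinuous_le (hN : RegularizingNoise P ℱ H K Y)
    (hθ : AdmissibleExponent d H p q θ) (hφ : ControlledPath P ℱ φ v) {g : ℝ × E d →ᵇ ℝ}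
    (hg : 0 ≤ g) (hs : 0 ≤ s) (hst : s < t) (ht : t ≤ 1) (hB : MeasurableSet[ℱ s] B) :
    pathIntegral P B g φ Y s t ≤ sewingConst d K H p q θ * scalarMixedNorm p q s t g *
      sewingBound d H p q θ (t - s) (P B) (∫⁻ ω in B, timeIntegral v s t ω ∂P) := by
  let F (n : ℕ) : ℝ → Ω → ℝ≥0∞ := pathDensity g (fun r => φ (dyadicLeft s t n r)) Y
  have F_measurable (n : ℕ) : Measurable fun z : ℝ × Ω => F n z.1 z.2 :=
    measurable_pathDensity g.continuous.measurable (hφ.measurable_uncurry.comp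
      (((measurable_dyadicLeft s t n).comp measurable_fst).prodMk measurable_snd)) hN.measurable
  have F_tendsto : ∀ r ∈ Ioc s t, ∀ ω,
      Tendsto (fun n => F n r ω) atTop (𝓝 (pathDensity g φ Y r ω)) := fun r hr ω => by
    have path_tendsto : Tendsto (fun n => φ (dyadicLeft s t n r) ω) atTop (𝓝 (φ r ω)) :=
      ((hφ.continuous ω).tendsto r).comp (tendsto_dyadicLeft hst hr.1)
    exact ENNReal.tendsto_ofReal ((g.continuous.tendsto _).comp
      (tendsto_const_nhds.prodMk_nhds (path_tendsto.add_const (Y r ω))))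
  calc pathIntegral P B g φ Y s t
      = ∫⁻ r in Ioc s t, ∫⁻ ω in B, liminf (fun n => F n r ω) atTop ∂P :=
        setLIntegral_congr_fun measurableSet_Ioc fun r hr =>
          lintegral_congr fun ω => (F_tendsto r hr ω).liminf_eq.symm
    _ ≤ ∫⁻ r in Ioc s t, liminf (fun n => ∫⁻ ω in B, F n r ω ∂P) atTop :=
        lintegral_mono fun r =>
          lintegral_liminf_le fun n => (F_measurable n).comp measurable_prodMk_left
    _ ≤ liminf (fun n => ∫⁻ r in Ioc s t, ∫⁻ ω in B, F n r ω ∂P) atTop :=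
        lintegral_liminf_le fun n => (F_measurable n).lintegral_prod_right'
    _ ≤ _ := by
        refine liminf_le_of_le (by isBoundedDefault) fun b hb => ?_
        obtain ⟨n, hn⟩ := hb.exists
        refine hn.trans ?_
        rw [← pathIntegral, ← dyadicSum_eq_pathIntegral _ hst]
        exact hN.dyadicSum_le hθ hφ hg hs hst.le ht hB n

lemma sewingBound_ne_top {δ : ℝ} {b y : ℝ≥0∞} (hθ0 : 0 ≤ θ) (hθ1 : θ ≤ 1) (hb : b ≠ ∞)
    (hy : y ≠ ∞) : sewingBound d H p q θ δ b y ≠ ∞ :=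
  ENNReal.add_ne_top.2 ⟨ENNReal.mul_ne_top ENNReal.ofReal_ne_top hb,
    ENNReal.mul_ne_top (ENNReal.mul_ne_top ENNReal.ofReal_ne_top
      (ENNReal.rpow_ne_top_of_nonneg (sub_nonneg.2 hθ1) hb))
      (ENNReal.rpow_ne_top_of_nonneg hθ0 hy)⟩

lemma RegularizingNoise.pathIntegral_le (hN : RegularizingNoise P ℱ H K Y)
    (hθ : AdmissibleExponent d H p q θ) (hφ : ControlledPath P ℱ φ v) (hs : 0 ≤ s) (hst : s < t)
    (ht : t ≤ 1) (hB : MeasurableSet[ℱ s] B) (hv : ∫⁻ ω in B, timeIntegral v s t ω ∂P ≠ ∞)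
    {f : ℝ × E d → ℝ} (hf : Measurable f) {M : ℝ} (hf_mem : ∀ z, f z ∈ Icc 0 M) :
    pathIntegral P B f φ Y s t ≤ sewingConst d K H p q θ * scalarMixedNorm p q s t f *
      sewingBound d H p q θ (t - s) (P B) (∫⁻ ω in B, timeIntegral v s t ω ∂P) := by
  have graph_measurable : Measurable fun z : ℝ × Ω => (z.1, φ z.1 z.2 + Y z.1 z.2) :=
    measurable_fst.prodMk (hφ.measurable_uncurry.add hN.measurable)
  let μ := ((volume.restrict (Ioc s t)).prod (P.restrict B)).map
    fun z => (z.1, φ z.1 z.2 + Y z.1 z.2)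
  have integral_eq {g : ℝ × E d → ℝ} (hg : Measurable g) :
      ∫⁻ z, ENNReal.ofReal (g z) ∂μ = pathIntegral P B g φ Y s t := by
    rw [lintegral_map hg.ennreal_ofReal graph_measurable]
    exact lintegral_prod _ (hg.ennreal_ofReal.comp graph_measurable).aemeasurable
  have bound_ne_top : sewingConst d K H p q θ * sewingBound d H p q θ (t - s) (P B)
      (∫⁻ ω in B, timeIntegral v s t ω ∂P) ≠ ∞ :=
    ENNReal.mul_ne_top (sewingConst_ne_top hθ.mul_hurst_lt)
      (sewingBound_ne_top hθ.nonneg hθ.lt_one.le (measure_ne_top P B) hv)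
  rw [← integral_eq hf, mul_right_comm]
  refine lintegral_le_scalarMixedNorm_of_boundedContinuous (zero_lt_one.trans_le hθ.one_le_p)
    (zero_lt_one.trans hθ.one_lt_q) bound_ne_top (fun g hg => ?_) hf hf_mem
  rw [integral_eq g.continuous.measurable, mul_right_comm]
  exact hN.pathIntegral_boundedContinuous_le hθ hφ hg hs hst ht hB

end SewingEstimate

/-! ### Khasminskii's lemma -/

section Absorption

lemma le_of_le_rpow_mul_rpow {x y : ℝ≥0∞} {θ : ℝ} (hθ : θ < 1) (hy : y ≠ ∞) (h : y ≤ x * y ^ θ) :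
    y ≤ x ^ (1 / (1 - θ)) := by
  rcases eq_or_ne y 0 with rfl | hy0
  · exact zero_le
  have hθ' : 0 < 1 - θ := sub_pos.2 hθ
  have rpow_le : y ^ (1 - θ) ≤ x := by
    rw [ENNReal.rpow_sub _ _ hy0 hy, ENNReal.rpow_one]
    exact (ENNReal.div_le_iff (by simp [hy0, hy]) (by simp [hy0, hy])).2 h
  calc y = (y ^ (1 - θ)) ^ (1 / (1 - θ)) := by
        rw [← ENNReal.rpow_mul, mul_one_div_cancel hθ'.ne', ENNReal.rpow_one]
    _ ≤ x ^ (1 / (1 - θ)) := ENNReal.rpow_le_rpow rpow_le (by positivity)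

lemma le_of_le_add_rpow {x y a b : ℝ≥0∞} {θ : ℝ} (hθ : θ < 1) (hy : y ≠ ∞)
    (h : y ≤ a * x + b * x ^ (1 - θ) * y ^ θ) :
    y ≤ (2 * a + (2 * b) ^ (1 / (1 - θ))) * x := by
  have hθ' : 0 < 1 - θ := sub_pos.2 hθ
  rw [add_mul]
  rcases le_total (b * x ^ (1 - θ) * y ^ θ) (a * x) with h_le | h_le
  · refine le_add_right (h.trans ((add_le_add_right h_le _).trans_eq ?_))
    ring
  · have le_mul : y ≤ 2 * b * x ^ (1 - θ) * y ^ θ := by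
      refine h.trans ((add_le_add_left h_le _).trans_eq ?_)
      ring
    refine le_add_left ((le_of_le_rpow_mul_rpow hθ hy le_mul).trans_eq ?_)
    rw [ENNReal.mul_rpow_of_nonneg _ _ (by positivity), ← ENNReal.rpow_mul,
      mul_one_div_cancel hθ'.ne', ENNReal.rpow_one]

lemma rpow_le_add_rpow (x : ℝ≥0∞) {k q : ℝ} (hk : 1 ≤ k) (hkq : k ≤ q) : x ^ k ≤ x + x ^ q := by
  rcases le_total x 1 with h | h
  · refine le_add_right ?_
    simpa using ENNReal.rpow_le_rpow_of_exponent_ge h hk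
  · exact le_add_left (ENNReal.rpow_le_rpow_of_exponent_le h hkq)

end Absorption

section Khasminskii

lemma setLIntegral_mul_setLIntegral_Ioc_swap {A w : ℝ → ℝ≥0∞} (hA : Measurable A)
    (hw : Measurable w) (s t : ℝ) :
    ∫⁻ r in Ioc s t, A r * ∫⁻ u in Ioc s r, w u = ∫⁻ u in Ioc s t, w u * ∫⁻ r in Ioc u t, A r := by
  let S : Set (ℝ × ℝ) := {z | z.2 ≤ z.1}
  let F : ℝ × ℝ → ℝ≥0∞ := S.indicator fun z => A z.1 * w z.2
  have F_measurable : Measurable F :=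
    ((hA.comp measurable_fst).mul (hw.comp measurable_snd)).indicator
      (measurableSet_le measurable_snd measurable_fst)
  have left_eq : ∀ r ∈ Ioc s t, A r * ∫⁻ u in Ioc s r, w u = ∫⁻ u in Ioc s t, F (r, u) := by
    intro r hr
    calc A r * ∫⁻ u in Ioc s r, w u = ∫⁻ u in Iic r ∩ Ioc s t, A r * w u := by
          rw [lintegral_const_mul _ hw, inter_comm, Ioc_inter_Iic, min_eq_right hr.2]
      _ = ∫⁻ u in Ioc s t, (Iic r).indicator (fun u => A r * w u) u :=
          (setLIntegral_indicator measurableSet_Iic _).symm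
  have right_eq : ∀ u ∈ Ioc s t, w u * ∫⁻ r in Ioc u t, A r = ∫⁻ r in Ioc s t, F (r, u) := by
    intro u hu
    have inter_eq : Ici u ∩ Ioc s t = Icc u t := by
      ext r
      simp only [mem_inter_iff, mem_Ici, mem_Ioc, mem_Icc]
      exact ⟨fun h => ⟨h.1, h.2.2⟩, fun h => ⟨h.1, hu.1.trans_le h.1, h.2⟩⟩
    calc w u * ∫⁻ r in Ioc u t, A r = ∫⁻ r in Ici u ∩ Ioc s t, A r * w u := by
          rw [lintegral_mul_const _ hA, inter_eq, mul_comm,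
            setLIntegral_congr (Ioc_ae_eq_Icc (μ := volume))]
      _ = ∫⁻ r in Ioc s t, (Ici u).indicator (fun r => A r * w u) r :=
          (setLIntegral_indicator measurableSet_Ici _).symm
  rw [setLIntegral_congr_fun measurableSet_Ioc left_eq,
    setLIntegral_congr_fun measurableSet_Ioc right_eq]
  exact lintegral_lintegral_swap F_measurable.aemeasurable

lemma pow_setLIntegral_Ioc {w : ℝ → ℝ≥0∞} (hw : Measurable w) (t : ℝ) (n : ℕ) (s : ℝ) :
    (∫⁻ r in Ioc s t, w r) ^ (n + 1) =
      (n + 1) * ∫⁻ r in Ioc s t, w r * (∫⁻ u in Ioc r t, w u) ^ n := by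
  induction n generalizing s with
  | zero => simp
  | succ n ih =>
    set W : ℝ → ℝ≥0∞ := fun r => ∫⁻ u in Ioc r t, w u
    have W_measurable : Measurable W :=
      Antitone.measurable fun a b hab => lintegral_mono_set (Ioc_subset_Ioc_left hab)
    have power_measurable : Measurable fun r => w r * W r ^ n := hw.mul (W_measurable.pow_const n)
    have split : (∫⁻ r in Ioc s t, w r * W r ^ n) * W s =
        (∫⁻ r in Ioc s t, w r * W r ^ n * ∫⁻ u in Ioc s r, w u) +
          ∫⁻ r in Ioc s t, w r * W r ^ (n + 1) := by
      rw [← lintegral_mul_const _ power_measurable, ← lintegral_add_right _ (by fun_prop)]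
      refine setLIntegral_congr_fun measurableSet_Ioc fun r hr => ?_
      have W_split : W s = (∫⁻ u in Ioc s r, w u) + W r :=
        (setLIntegral_Ioc_add w hr.1.le hr.2).symm
      rw [W_split, pow_succ]
      ring
    have swap : ((n : ℝ≥0∞) + 1) * (∫⁻ r in Ioc s t, w r * W r ^ n * ∫⁻ u in Ioc s r, w u) =
        ∫⁻ r in Ioc s t, w r * W r ^ (n + 1) := by
      rw [setLIntegral_mul_setLIntegral_Ioc_swap power_measurable hw,
        ← lintegral_const_mul' _ _ (by finiteness)]
      refine lintegral_congr fun r => ?_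
      rw [mul_left_comm, ← ih r]
    rw [pow_succ, ih s, mul_assoc, split, mul_add, swap]
    push_cast
    ring

lemma lintegral_mul_le_of_forall_setLIntegral_le {Ω : Type*} {m mΩ : MeasurableSpace Ω}
    {μ : Measure Ω} (hm : m ≤ mΩ) {X φ : Ω → ℝ≥0∞} (hX : Measurable X)
    (hφ : AEStronglyMeasurable[m] φ μ) {c : ℝ≥0∞}
    (h : ∀ S : Set Ω, MeasurableSet[m] S → ∫⁻ ω in S, X ω ∂μ ≤ c * μ S) :
    ∫⁻ ω, φ ω * X ω ∂μ ≤ c * ∫⁻ ω, φ ω ∂μ := by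
  obtain ⟨ψ, hψ, hφψ⟩ := hφ
  have trim_le : (μ.withDensity X).trim hm ≤ c • μ.trim hm := by
    refine Measure.le_iff.2 fun S hS => ?_
    rw [trim_measurableSet_eq hm hS, Measure.smul_apply, trim_measurableSet_eq hm hS,
      withDensity_apply _ (hm _ hS)]
    exact h S hS
  calc ∫⁻ ω, φ ω * X ω ∂μ = ∫⁻ ω, ψ ω ∂(μ.withDensity X) := by
        rw [lintegral_withDensity_eq_lintegral_mul _ hX (hψ.measurable.mono hm le_rfl)]
        refine lintegral_congr_ae ?_
        filter_upwards [hφψ] with ω hω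
        rw [hω, Pi.mul_apply, mul_comm]
    _ ≤ c * ∫⁻ ω, ψ ω ∂μ := by
        rw [← lintegral_trim hm hψ.measurable, ← lintegral_trim hm hψ.measurable, ← smul_eq_mul,
          ← lintegral_smul_measure]
        exact lintegral_mono' trim_le le_rfl
    _ = c * ∫⁻ ω, φ ω ∂μ := by rw [lintegral_congr_ae hφψ]

variable {Ω : Type*} {mΩ : MeasurableSpace Ω} {P : Measure Ω} {v : ℝ → Ω → ℝ≥0∞}

lemma measurable_timeIntegral_left (hv : Measurable fun z : ℝ × Ω => v z.1 z.2) (t : ℝ) :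
    Measurable fun z : ℝ × Ω => timeIntegral v z.1 t z.2 := by
  let S : Set ((ℝ × Ω) × ℝ) := {z | z.1.1 < z.2 ∧ z.2 ≤ t}
  have S_measurable : MeasurableSet S :=
    (measurableSet_lt (measurable_fst.comp measurable_fst) measurable_snd).inter
      (measurableSet_le measurable_snd measurable_const)
  have density_measurable : Measurable fun z : (ℝ × Ω) × ℝ => v z.2 z.1.2 :=
    hv.comp (measurable_snd.prodMk (measurable_snd.comp measurable_fst))
  simp_rw [timeIntegral, ← lintegral_indicator measurableSet_Ioc]
  exact (density_measurable.indicator S_measurable).lintegral_prod_right'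

lemma setLIntegral_timeIntegral_pow_le [SFinite P] {ℱ : Filtration ℝ mΩ}
    (hv : Measurable fun z : ℝ × Ω => v z.1 z.2) {s t : ℝ}
    (hv_adapted : ∀ r ∈ Icc s t, AEStronglyMeasurable[ℱ r] (v r) P) {Γ : ℝ≥0∞}
    (hΓ : ∀ r ∈ Icc s t, ∀ B : Set Ω, MeasurableSet[ℱ r] B →
      ∫⁻ ω in B, timeIntegral v r t ω ∂P ≤ Γ * P B) (n : ℕ) :
    ∀ r ∈ Icc s t, ∀ B : Set Ω, MeasurableSet[ℱ r] B →
      ∫⁻ ω in B, timeIntegral v r t ω ^ n ∂P ≤ n.factorial * Γ ^ n * P B := by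
  induction n with
  | zero => simp
  | succ n ih =>
    intro a ha B hB
    have chain_rule : ∫⁻ ω in B, timeIntegral v a t ω ^ (n + 1) ∂P =
        (n + 1) * ∫⁻ r in Ioc a t, ∫⁻ ω in B, v r ω * timeIntegral v r t ω ^ n ∂P := by
      rw [lintegral_lintegral_swap
        (hv.mul ((measurable_timeIntegral_left hv t).pow_const n)).aemeasurable,
        ← lintegral_const_mul' _ _ (by finiteness)]
      exact lintegral_congr fun ω => pow_setLIntegral_Ioc (hv.comp measurable_prodMk_right) t n a
    have condition_at : ∀ r ∈ Ioc a t, ∫⁻ ω in B, v r ω * timeIntegral v r t ω ^ n ∂P ≤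
        n.factorial * Γ ^ n * ∫⁻ ω in B, v r ω ∂P := by
      intro r hr
      have hr' : r ∈ Icc s t := ⟨ha.1.trans hr.1.le, hr.2⟩
      refine lintegral_mul_le_of_forall_setLIntegral_le (ℱ.le r)
        ((measurable_timeIntegral hv r t).pow_const n) (hv_adapted r hr').restrict fun S hS => ?_
      rw [Measure.restrict_restrict (ℱ.le r _ hS), Measure.restrict_apply (ℱ.le r _ hS)]
      exact ih r hr' _ (hS.inter (ℱ.mono hr.1.le _ hB))
    have integrate : ∫⁻ r in Ioc a t, ∫⁻ ω in B, v r ω * timeIntegral v r t ω ^ n ∂P ≤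
        n.factorial * Γ ^ n * ∫⁻ ω in B, timeIntegral v a t ω ∂P := by
      refine (setLIntegral_mono' measurableSet_Ioc condition_at).trans_eq ?_
      rw [lintegral_const_mul _ hv.lintegral_prod_right', lintegral_lintegral_swap hv.aemeasurable]
      rfl
    rw [chain_rule]
    refine (mul_le_mul_right (integrate.trans (mul_le_mul_right (hΓ a ha B hB) _)) _).trans_eq ?_
    rw [Nat.factorial_succ, pow_succ]
    push_cast
    ring

end Khasminskii

/-! ### Moments of the time integral -/

/-- The constant in the bound on the conditional moments of `∫ r in s..t, f (r, φ r + Y r)`. -/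
def momentConst (d : ℕ) (K : ℝ → ℝ≥0) (H p q θ : ℝ) : ℝ≥0∞ :=
  2 * sewingConst d K H p q θ + (2 * sewingConst d K H p q θ) ^ (1 / (1 - θ))

section Moments

variable {d : ℕ} {K : ℝ → ℝ≥0} {H p q θ e s t M : ℝ}

lemma momentConst_ne_top (hθ : AdmissibleExponent d H p q θ) : momentConst d K H p q θ ≠ ∞ := by
  have two_mul_ne_top : 2 * sewingConst d K H p q θ ≠ ∞ :=
    ENNReal.mul_ne_top ENNReal.ofNat_ne_top (sewingConst_ne_top hθ.mul_hurst_lt)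
  have : 0 < 1 - θ := sub_pos.2 hθ.lt_one
  exact ENNReal.add_ne_top.2
    ⟨two_mul_ne_top, ENNReal.rpow_ne_top_of_nonneg (by positivity) two_mul_ne_top⟩

lemma AdmissibleExponent.one_le_one_div_one_sub (hθ : AdmissibleExponent d H p q θ) :
    1 ≤ 1 / (1 - θ) :=
  one_le_one_div (sub_pos.2 hθ.lt_one) (sub_le_self _ hθ.nonneg)

lemma AdmissibleExponent.one_div_one_sub_le (hθ : AdmissibleExponent d H p q θ) :
    1 / (1 - θ) ≤ q := by
  have hq : 0 < q := zero_lt_one.trans hθ.one_lt_q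
  exact (one_div_le (sub_pos.2 hθ.lt_one) hq).2 (by linarith [hθ.lt_one_sub])

lemma AdmissibleExponent.two_mul_add_rpow_le (hθ : AdmissibleExponent d H p q θ)
    (he : e ≤ 1 - 1 / q - (d / p + θ) * H) {δ : ℝ} (hδ : 0 < δ) (hδ_le : δ ≤ 1) (G : ℝ≥0∞) :
    2 * (sewingConst d K H p q θ * G * ENNReal.ofReal (δ ^ (1 - 1 / q - d / p * H))) +
        (2 * (sewingConst d K H p q θ * G *
          ENNReal.ofReal (δ ^ (1 - 1 / q - (d / p + θ) * H)))) ^ (1 / (1 - θ)) ≤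
      momentConst d K H p q θ * (G + G ^ q) * ENNReal.ofReal (δ ^ e) := by
  set D := sewingConst d K H p q θ with D_def
  set k := 1 / (1 - θ) with k_def
  have one_le_k : 1 ≤ k := hθ.one_le_one_div_one_sub
  have k_nonneg : 0 ≤ k := zero_le_one.trans one_le_k
  have linear_le : ENNReal.ofReal (δ ^ (1 - 1 / q - d / p * H)) ≤ ENNReal.ofReal (δ ^ e) :=
    ENNReal.ofReal_le_ofReal (Real.rpow_le_rpow_of_exponent_ge hδ hδ_le
      (by linarith [hθ.div_mul_hurst_le]))
  have power_le : ENNReal.ofReal (δ ^ (1 - 1 / q - (d / p + θ) * H)) ^ k ≤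
      ENNReal.ofReal (δ ^ e) := by
    rw [ENNReal.ofReal_rpow_of_nonneg (by positivity) k_nonneg, ← Real.rpow_mul hδ.le]
    refine ENNReal.ofReal_le_ofReal (Real.rpow_le_rpow_of_exponent_ge hδ hδ_le (he.trans ?_))
    exact le_mul_of_one_le_right (by linarith [hθ.mul_hurst_lt_one_sub]) one_le_k
  rw [← mul_assoc, ← mul_assoc, ← mul_assoc, ← mul_assoc, ENNReal.mul_rpow_of_nonneg _ _ k_nonneg,
    ENNReal.mul_rpow_of_nonneg _ _ k_nonneg]
  calc 2 * D * G * ENNReal.ofReal (δ ^ (1 - 1 / q - d / p * H)) +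
        (2 * D) ^ k * G ^ k * ENNReal.ofReal (δ ^ (1 - 1 / q - (d / p + θ) * H)) ^ k
      ≤ 2 * D * (G + G ^ q) * ENNReal.ofReal (δ ^ e) +
        (2 * D) ^ k * (G + G ^ q) * ENNReal.ofReal (δ ^ e) := by
        gcongr
        · exact le_self_add
        · exact rpow_le_add_rpow G one_le_k hθ.one_div_one_sub_le
    _ = _ := by rw [momentConst, ← D_def, ← k_def]; ring

variable {Ω : Type*} {mΩ : MeasurableSpace Ω} {P : Measure Ω}
  {ℱ : Filtration ℝ mΩ} {Y φ : ℝ → Ω → E d} {f : ℝ × E d → ℝ} {B : Set Ω}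

lemma aestronglyMeasurable_pathDensity {r : ℝ} {m : MeasurableSpace Ω} (hf : Measurable f)
    (hφ : AEStronglyMeasurable[m] (φ r) P) (hY : Measurable[m] (Y r)) :
    AEStronglyMeasurable[m] (pathDensity f φ Y r) P := by
  obtain ⟨ξ, hξ, hφξ⟩ := hφ
  have section_measurable : Measurable fun z : E d => ENNReal.ofReal (f (r, z)) :=
    (hf.comp measurable_prodMk_left).ennreal_ofReal
  refine ⟨fun ω => ENNReal.ofReal (f (r, ξ ω + Y r ω)),
    (section_measurable.comp (hξ.measurable.add hY)).stronglyMeasurable, ?_⟩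
  filter_upwards [hφξ] with ω hω
  rw [pathDensity, hω]

variable [IsProbabilityMeasure P]

lemma setLIntegral_timeIntegral_pathDensity_ne_top (hf : ∀ z, f z ≤ M) :
    ∫⁻ ω in B, timeIntegral (pathDensity f φ Y) s t ω ∂P ≠ ∞ := by
  have timeIntegral_le (ω : Ω) : timeIntegral (pathDensity f φ Y) s t ω ≤
      ENNReal.ofReal M * ENNReal.ofReal (t - s) := by
    refine (lintegral_mono fun r => ENNReal.ofReal_le_ofReal (hf _)).trans_eq ?_
    rw [setLIntegral_const, Real.volume_Ioc]
  refine ne_top_of_le_ne_top ?_ (lintegral_mono timeIntegral_le)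
  rw [setLIntegral_const]
  finiteness

lemma RegularizingNoise.setLIntegral_timeIntegral_le (hN : RegularizingNoise P ℱ H K Y)
    (hθ : AdmissibleExponent d H p q θ) (he : e ≤ 1 - 1 / q - (d / p + θ) * H)
    (hφ : ControlledPath P ℱ φ (pathDensity f φ Y)) (hf : Measurable f)
    (hf_mem : ∀ z, f z ∈ Icc 0 M) (hs : 0 ≤ s) (hst : s ≤ t) (ht : t ≤ 1)
    (hB : MeasurableSet[ℱ s] B) :
    ∫⁻ ω in B, timeIntegral (pathDensity f φ Y) s t ω ∂P ≤
      momentConst d K H p q θ * (scalarMixedNorm p q s t f + scalarMixedNorm p q s t f ^ q) *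
        ENNReal.ofReal ((t - s) ^ e) * P B := by
  rcases hst.eq_or_lt with rfl | hst
  · simp [timeIntegral]
  have finite := setLIntegral_timeIntegral_pathDensity_ne_top (φ := φ) (Y := Y) (P := P) (B := B)
    (s := s) (t := t) fun z => (hf_mem z).2
  have sewing := hN.pathIntegral_le hθ hφ hs hst ht hB finite hf hf_mem
  have swap : pathIntegral P B f φ Y s t =
      ∫⁻ ω in B, timeIntegral (pathDensity f φ Y) s t ω ∂P :=
    lintegral_lintegral_swap hφ.measurable_density.aemeasurable
  rw [swap] at sewing
  refine (le_of_le_add_rpow hθ.lt_one finite (sewing.trans_eq ?_)).trans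
    (mul_le_mul_left (hθ.two_mul_add_rpow_le he (sub_pos.2 hst) (by linarith) _) _)
  rw [sewingBound]
  ring

lemma RegularizingNoise.lintegral_timeIntegral_pow_le (hN : RegularizingNoise P ℱ H K Y)
    (hθ : AdmissibleExponent d H p q θ) (he₀ : 0 ≤ e) (he : e ≤ 1 - 1 / q - (d / p + θ) * H)
    (hφ : ControlledPath P ℱ φ (pathDensity f φ Y)) (hf : Measurable f)
    (hf_mem : ∀ z, f z ∈ Icc 0 M) (hs : 0 ≤ s) (hst : s ≤ t) (ht : t ≤ 1) (n : ℕ) :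
    ∫⁻ ω, timeIntegral (pathDensity f φ Y) s t ω ^ n ∂P ≤
      n.factorial * (momentConst d K H p q θ *
        (scalarMixedNorm p q s t f + scalarMixedNorm p q s t f ^ q) *
          ENNReal.ofReal ((t - s) ^ e)) ^ n := by
  have density_adapted : ∀ r ∈ Icc s t, AEStronglyMeasurable[ℱ r] (pathDensity f φ Y r) P := by
    intro r hr
    have hr' : r ∈ Icc (0 : ℝ) 1 := ⟨hs.trans hr.1, hr.2.trans ht⟩
    exact aestronglyMeasurable_pathDensity hf (hφ.adapted r hr') (hN.adapted r hr')
  have first_moment : ∀ r ∈ Icc s t, ∀ B : Set Ω, MeasurableSet[ℱ r] B →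
      ∫⁻ ω in B, timeIntegral (pathDensity f φ Y) r t ω ∂P ≤ momentConst d K H p q θ *
        (scalarMixedNorm p q s t f + scalarMixedNorm p q s t f ^ q) *
          ENNReal.ofReal ((t - s) ^ e) * P B := by
    intro r hr B hB
    refine (hN.setLIntegral_timeIntegral_le hθ he hφ hf hf_mem (hs.trans hr.1) hr.2 ht hB).trans ?_
    have hq : 0 ≤ q := zero_le_one.trans hθ.one_lt_q.le
    have norm_le := scalarMixedNorm_mono (p := p) hq f hr.1 (le_refl t)
    have rpow_le : (t - r) ^ e ≤ (t - s) ^ e :=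
      Real.rpow_le_rpow (sub_nonneg.2 hr.2) (sub_le_sub_left hr.1 t) he₀
    gcongr
  simpa using setLIntegral_timeIntegral_pow_le hφ.measurable_density density_adapted first_moment n
    s ⟨le_rfl, hst⟩ univ MeasurableSet.univ

end Moments

/-! ### Hölder norms from dyadic increments -/

/-- A random variable whose `n`-th root dominates, up to a constant, the Hölder norm of exponent `γ`
on `[0,1]` of every path with increments bounded by the time integrals of `v`. -/
def holderMajorant {Ω : Type*} (v : ℝ → Ω → ℝ≥0∞) (γ : ℝ) (n : ℕ) (ω : Ω) : ℝ≥0∞ :=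
  ∑' k : ℕ, ∑ i ∈ Finset.range (2 ^ k), (ENNReal.ofReal (2 ^ γ) ^ k *
    timeIntegral v (dyadicPt 0 1 k i) (dyadicPt 0 1 k (i + 1)) ω) ^ n

section Holder

variable {Ω : Type*} {v : ℝ → Ω → ℝ≥0∞} {γ s t : ℝ} {n k i : ℕ}

lemma dyadicPt_zero_one (k i : ℕ) : dyadicPt 0 1 k i = i / 2 ^ k := by
  simp [dyadicPt, div_eq_mul_inv]

lemma exists_dyadicPt_le_le (hs : 0 ≤ s) (hst : s < t) (ht : t ≤ 1) :
    ∃ k i : ℕ, i < 2 ^ k ∧ dyadicPt 0 1 k i ≤ s ∧ t ≤ dyadicPt 0 1 k (i + 2) ∧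
      (1 / 2 : ℝ) ^ (k + 1) ≤ t - s := by
  obtain ⟨k, lt_sub, sub_le⟩ := exists_nat_pow_near_of_lt_one (x := t - s) (y := (1 / 2 : ℝ))
    (sub_pos.2 hst) (by linarith) (by norm_num) (by norm_num)
  have two_pow_pos : (0 : ℝ) < 2 ^ k := by positivity
  have floor_le : (⌊s * 2 ^ k⌋₊ : ℝ) ≤ s * 2 ^ k := Nat.floor_le (by positivity)
  have scaled_sub_le : (t - s) * 2 ^ k ≤ 1 :=
    calc (t - s) * 2 ^ k ≤ (1 / 2) ^ k * 2 ^ k := by gcongr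
      _ = 1 := by rw [← mul_pow]; norm_num
  refine ⟨k, ⌊s * 2 ^ k⌋₊, ?_, ?_, ?_, lt_sub.le⟩
  · have : s * 2 ^ k < 2 ^ k := mul_lt_of_lt_one_left two_pow_pos (hst.trans_le ht)
    exact_mod_cast floor_le.trans_lt this
  · rwa [dyadicPt_zero_one, div_le_iff₀ two_pow_pos]
  · rw [dyadicPt_zero_one, le_div_iff₀ two_pow_pos]
    push_cast
    linarith [Nat.lt_floor_add_one (s * 2 ^ k)]

lemma mul_timeIntegral_dyadicPt_le (hn : n ≠ 0) (hi : i < 2 ^ k) (ω : Ω) :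
    ENNReal.ofReal (2 ^ γ) ^ k * timeIntegral v (dyadicPt 0 1 k i) (dyadicPt 0 1 k (i + 1)) ω ≤
      holderMajorant v γ n ω ^ (1 / (n : ℝ)) := by
  rw [one_div, ENNReal.le_rpow_inv_iff (by positivity), ENNReal.rpow_natCast]
  refine le_trans ?_ (ENNReal.le_tsum k)
  exact Finset.single_le_sum (f := fun i => (ENNReal.ofReal (2 ^ γ) ^ k *
    timeIntegral v (dyadicPt 0 1 k i) (dyadicPt 0 1 k (i + 1)) ω) ^ n) (fun _ _ => zero_le)
    (Finset.mem_range.2 hi)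

lemma mul_timeIntegral_le_two_mul (hn : n ≠ 0) (ht : t ≤ 1) (hi : i < 2 ^ k)
    (hs : dyadicPt 0 1 k i ≤ s) (hti : t ≤ dyadicPt 0 1 k (i + 2)) (ω : Ω) :
    ENNReal.ofReal (2 ^ γ) ^ k * timeIntegral v s t ω ≤
      2 * holderMajorant v γ n ω ^ (1 / (n : ℝ)) := by
  have mono := dyadicPt_mono (zero_le_one' ℝ) k
  rw [two_mul]
  rcases (Nat.succ_le_of_lt hi).eq_or_lt with h_last | h_lt
  · refine le_add_right (le_trans ?_ (mul_timeIntegral_dyadicPt_le hn hi ω))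
    have t_le : t ≤ dyadicPt 0 1 k (i + 1) := by rwa [← Nat.succ_eq_add_one, h_last, dyadicPt_last]
    gcongr
    exact timeIntegral_mono v hs t_le ω
  · calc ENNReal.ofReal (2 ^ γ) ^ k * timeIntegral v s t ω
        ≤ ENNReal.ofReal (2 ^ γ) ^ k *
          timeIntegral v (dyadicPt 0 1 k i) (dyadicPt 0 1 k (i + 2)) ω := by
          gcongr
          exact timeIntegral_mono v hs hti ω
      _ = ENNReal.ofReal (2 ^ γ) ^ k *
            timeIntegral v (dyadicPt 0 1 k i) (dyadicPt 0 1 k (i + 1)) ω +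
          ENNReal.ofReal (2 ^ γ) ^ k *
            timeIntegral v (dyadicPt 0 1 k (i + 1)) (dyadicPt 0 1 k (i + 1 + 1)) ω := by
          rw [← mul_add]
          exact congrArg _ (setLIntegral_Ioc_add _ (mono i.le_succ) (mono (i + 1).le_succ)).symm
      _ ≤ _ := add_le_add (mul_timeIntegral_dyadicPt_le hn hi ω)
          (mul_timeIntegral_dyadicPt_le hn h_lt ω)

lemma one_le_ofReal_two_rpow_pow_mul (hγ : 0 ≤ γ) {δ : ℝ} (hδ : (1 / 2 : ℝ) ^ k ≤ δ) :
    1 ≤ ENNReal.ofReal (2 ^ γ) ^ k * ENNReal.ofReal (δ ^ γ) := by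
  have δ_nonneg : 0 ≤ δ := le_trans (by positivity) hδ
  rw [← ENNReal.ofReal_pow (by positivity), ← ENNReal.ofReal_mul (by positivity),
    Real.rpow_pow_comm zero_le_two, ← Real.mul_rpow (by positivity) δ_nonneg, ENNReal.one_le_ofReal]
  refine Real.one_le_rpow ?_ hγ
  calc (1 : ℝ) = 2 ^ k * (1 / 2) ^ k := by rw [← mul_pow]; norm_num
    _ ≤ 2 ^ k * δ := by gcongr

lemma timeIntegral_div_le (hγ₀ : 0 ≤ γ) (hγ₁ : γ ≤ 1) (hn : n ≠ 0) (hs : 0 ≤ s) (hst : s < t)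
    (ht : t ≤ 1) (ω : Ω) :
    timeIntegral v s t ω / ENNReal.ofReal ((t - s) ^ γ) ≤
      4 * holderMajorant v γ n ω ^ (1 / (n : ℝ)) := by
  obtain ⟨k, i, hi, his, hti, hk⟩ := exists_dyadicPt_le_le hs hst ht
  set X := holderMajorant v γ n ω ^ (1 / (n : ℝ))
  set b := ENNReal.ofReal (2 ^ γ)
  set T := ENNReal.ofReal ((t - s) ^ γ)
  have b_le : b ≤ 2 := by
    rw [← ENNReal.ofReal_ofNat 2]
    exact ENNReal.ofReal_le_ofReal (Real.rpow_le_self_of_one_le one_le_two hγ₁)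
  refine ENNReal.div_le_of_le_mul ?_
  calc timeIntegral v s t ω ≤ timeIntegral v s t ω * (b ^ (k + 1) * T) :=
        le_mul_of_one_le_right zero_le (one_le_ofReal_two_rpow_pow_mul hγ₀ hk)
    _ = b * (b ^ k * timeIntegral v s t ω) * T := by ring
    _ ≤ 2 * (2 * X) * T :=
        mul_le_mul_left (mul_le_mul' b_le (mul_timeIntegral_le_two_mul hn ht hi his hti ω)) T
    _ = 4 * X * T := by ring

lemma holderNorm_le {d : ℕ} {g : ℝ → E d} {ω : Ω} (hg₀ : g 0 = 0)
    (hg : ∀ a b : ℝ, 0 ≤ a → a ≤ b → b ≤ 1 → ‖g b - g a‖ₑ ≤ timeIntegral v a b ω) (hγ₀ : 0 ≤ γ)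
    (hγ₁ : γ ≤ 1) (hn : n ≠ 0) :
    holderNorm γ g ≤ 5 * holderMajorant v γ n ω ^ (1 / (n : ℝ)) := by
  set X := holderMajorant v γ n ω ^ (1 / (n : ℝ))
  have total_le : timeIntegral v 0 1 ω ≤ X := by
    simpa [dyadicPt, X] using
      mul_timeIntegral_dyadicPt_le (v := v) (γ := γ) hn (pow_pos two_pos 0) ω
  have sup_le : (⨆ t ∈ Icc (0 : ℝ) 1, ‖g t‖ₑ) ≤ X := by
    refine iSup₂_le fun t ht => ?_
    calc ‖g t‖ₑ = ‖g t - g 0‖ₑ := by rw [hg₀, sub_zero]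
      _ ≤ timeIntegral v 0 t ω := hg 0 t le_rfl ht.1 ht.2
      _ ≤ timeIntegral v 0 1 ω := timeIntegral_mono v le_rfl ht.2 ω
      _ ≤ X := total_le
  have seminorm_le : (⨆ s ∈ Icc (0 : ℝ) 1, ⨆ t ∈ Icc (0 : ℝ) 1, ⨆ _ : s < t,
      ‖g t - g s‖ₑ / ENNReal.ofReal ((t - s) ^ γ)) ≤ 4 * X := by
    refine iSup₂_le fun s hs => iSup₂_le fun t ht => iSup_le fun hst => ?_
    exact (ENNReal.div_le_div_right (hg s t hs.1 hst.le ht.2) _).trans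
      (timeIntegral_div_le hγ₀ hγ₁ hn hs.1 hst ht.2 ω)
  calc holderNorm γ g ≤ X + 4 * X := add_le_add sup_le seminorm_le
    _ = 5 * X := by ring

lemma two_pow_mul_ofReal_two_rpow_pow (γ e : ℝ) (n k : ℕ) :
    (2 ^ k : ℕ) * ((ENNReal.ofReal (2 ^ γ) ^ k) ^ n * ENNReal.ofReal ((1 / 2 ^ k) ^ e) ^ n) =
      ENNReal.ofReal (2 ^ (1 + n * (γ - e))) ^ k := by
  rw [← ENNReal.ofReal_natCast, ← ENNReal.ofReal_pow (by positivity),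
    ← ENNReal.ofReal_pow (by positivity), ← ENNReal.ofReal_pow (by positivity),
    ← ENNReal.ofReal_pow (by positivity), ← ENNReal.ofReal_mul (by positivity),
    ← ENNReal.ofReal_mul (by positivity)]
  congr 1
  push_cast
  simp only [one_div, ← Real.rpow_natCast, ← Real.rpow_neg zero_le_two, ← Real.rpow_mul zero_le_two,
    ← Real.rpow_add zero_lt_two]
  ring_nf

variable [MeasurableSpace Ω] {P : Measure Ω}

lemma measurable_mul_timeIntegral_pow (hv : Measurable fun z : ℝ × Ω => v z.1 z.2) (b : ℝ≥0∞)
    (s t : ℝ) (n : ℕ) : Measurable fun ω => (b * timeIntegral v s t ω) ^ n :=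
  ((measurable_timeIntegral hv s t).const_mul b).pow_const n

lemma measurable_holderMajorant (hv : Measurable fun z : ℝ × Ω => v z.1 z.2) (γ : ℝ) (n : ℕ) :
    Measurable (holderMajorant v γ n) :=
  Measurable.tsum fun _ => Finset.measurable_sum _ fun _ _ =>
    measurable_mul_timeIntegral_pow hv _ _ _ _

lemma lintegral_holderMajorant_le (hv : Measurable fun z : ℝ × Ω => v z.1 z.2) {e : ℝ} {A : ℝ≥0∞}
    (h_moment : ∀ s t : ℝ, 0 ≤ s → s ≤ t → t ≤ 1 →
      ∫⁻ ω, timeIntegral v s t ω ^ n ∂P ≤ A * ENNReal.ofReal ((t - s) ^ e) ^ n) :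
    ∫⁻ ω, holderMajorant v γ n ω ∂P ≤ A * (1 - ENNReal.ofReal (2 ^ (1 + n * (γ - e))))⁻¹ := by
  have term_le (k i : ℕ) (hi : i ∈ Finset.range (2 ^ k)) : ∫⁻ ω, (ENNReal.ofReal (2 ^ γ) ^ k *
      timeIntegral v (dyadicPt 0 1 k i) (dyadicPt 0 1 k (i + 1)) ω) ^ n ∂P ≤
      (ENNReal.ofReal (2 ^ γ) ^ k) ^ n * (A * ENNReal.ofReal ((1 / 2 ^ k) ^ e) ^ n) := by
    have mono := dyadicPt_mono (zero_le_one' ℝ) k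
    have zero_le_left : 0 ≤ dyadicPt 0 1 k i := by simpa using mono i.zero_le
    have right_le_one : dyadicPt 0 1 k (i + 1) ≤ 1 := by
      simpa using mono (Nat.succ_le_of_lt (Finset.mem_range.1 hi))
    simp_rw [mul_pow]
    rw [lintegral_const_mul _ ((measurable_timeIntegral hv _ _).pow_const n),
      ← sub_zero (1 : ℝ), ← dyadicPt_succ_sub 0 1 k i, sub_zero]
    gcongr
    exact h_moment _ _ zero_le_left (mono i.le_succ) right_le_one
  have level_le (k : ℕ) : ∫⁻ ω, ∑ i ∈ Finset.range (2 ^ k), (ENNReal.ofReal (2 ^ γ) ^ k *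
      timeIntegral v (dyadicPt 0 1 k i) (dyadicPt 0 1 k (i + 1)) ω) ^ n ∂P ≤
      A * ENNReal.ofReal (2 ^ (1 + n * (γ - e))) ^ k := by
    rw [lintegral_finsetSum _ fun i _ => measurable_mul_timeIntegral_pow hv _ _ _ _]
    refine (Finset.sum_le_sum (term_le k)).trans_eq ?_
    rw [Finset.sum_const, Finset.card_range, nsmul_eq_mul, ← two_pow_mul_ofReal_two_rpow_pow]
    ring
  calc ∫⁻ ω, holderMajorant v γ n ω ∂P
      = ∑' k, ∫⁻ ω, ∑ i ∈ Finset.range (2 ^ k), (ENNReal.ofReal (2 ^ γ) ^ k *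
          timeIntegral v (dyadicPt 0 1 k i) (dyadicPt 0 1 k (i + 1)) ω) ^ n ∂P :=
        lintegral_tsum fun k => (Finset.measurable_sum _ fun i _ =>
          measurable_mul_timeIntegral_pow hv _ _ _ _).aemeasurable
    _ ≤ ∑' k, A * ENNReal.ofReal (2 ^ (1 + n * (γ - e))) ^ k := ENNReal.tsum_le_tsum level_le
    _ = _ := by rw [ENNReal.tsum_mul_left, ENNReal.tsum_geometric]

end Holder

/-! ### Solutions of the equation -/

section Drift

variable {d : ℕ} {x : E d} {f : ℝ → E d → E d}

/-- The norm of the drift as a function of time and of the path `ψ + Y`, that is, with the space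
variable shifted by the initial value `x`; it is set to zero off the time interval `[0,1]`. -/
def driftNorm (x : E d) (f : ℝ → E d → E d) (z : ℝ × E d) : ℝ :=
  (Icc (0 : ℝ) 1).indicator (fun r => ‖f r (x + z.2)‖) z.1

lemma driftNorm_of_mem {r : ℝ} (hr : r ∈ Icc (0 : ℝ) 1) (y : E d) :
    driftNorm x f (r, y) = ‖f r (x + y)‖ :=
  indicator_of_mem hr _

lemma driftNorm_mem_Icc {M : ℝ} (hM : ∀ r ∈ Icc (0 : ℝ) 1, ∀ y, ‖f r y‖ ≤ M) (z : ℝ × E d) :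
    driftNorm x f z ∈ Icc 0 M := by
  have M_nonneg : 0 ≤ M := (norm_nonneg _).trans (hM 0 ⟨le_rfl, zero_le_one⟩ 0)
  exact ⟨indicator_nonneg (fun _ _ => norm_nonneg _) _,
    indicator_le' (fun r hr => hM r hr _) (fun _ _ => M_nonneg) _⟩

lemma measurable_driftNorm (x : E d) (hf : Measurable fun z : ℝ × E d => f z.1 z.2) :
    Measurable (driftNorm x f) :=
  Measurable.indicator (s := {z : ℝ × E d | z.1 ∈ Icc (0 : ℝ) 1})
    (hf.comp (measurable_fst.prodMk (measurable_snd.const_add x))).norm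
    (measurable_fst measurableSet_Icc)

lemma scalarMixedNorm_driftNorm (x : E d) (hf : Measurable fun z : ℝ × E d => f z.1 z.2)
    (p q : ℝ) {s t : ℝ} (hs : 0 ≤ s) (ht : t ≤ 1) :
    scalarMixedNorm p q s t (driftNorm x f) = mixedNorm p q s t f := by
  rw [scalarMixedNorm, mixedNorm, setLIntegral_congr Ioc_ae_eq_Icc.symm]
  congr 1
  refine setLIntegral_congr_fun measurableSet_Ioc fun r hr => ?_
  have hr' : r ∈ Icc (0 : ℝ) 1 := ⟨hs.trans hr.1.le, hr.2.trans ht⟩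
  simp only [driftNorm_of_mem hr']
  rw [eLpNorm_norm]
  exact congrArg (· ^ q) (eLpNorm_comp_measurePreserving (g := f r)
    (hf.comp measurable_prodMk_left).aestronglyMeasurable (measurePreserving_add_left volume x))

end Drift

section Primitive

variable {F : Type*} [NormedAddCommGroup F] [NormedSpace ℝ F] {u g : ℝ → F}

lemma continuousOn_of_eq_integral (hu : IntegrableOn u (Icc 0 1))
    (hg : ∀ t ∈ Icc (0 : ℝ) 1, g t = ∫ r in (0 : ℝ)..t, u r) : ContinuousOn g (Icc 0 1) := by
  rw [← uIcc_of_le zero_le_one] at hu hg ⊢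
  exact (intervalIntegral.continuousOn_primitive_interval hu).congr hg

lemma enorm_sub_le_of_eq_integral (hu : IntegrableOn u (Icc 0 1))
    (hg : ∀ t ∈ Icc (0 : ℝ) 1, g t = ∫ r in (0 : ℝ)..t, u r) {a b : ℝ} (ha : 0 ≤ a) (hab : a ≤ b)
    (hb : b ≤ 1) : ‖g b - g a‖ₑ ≤ ∫⁻ r in Ioc a b, ‖u r‖ₑ := by
  have integrable : ∀ c ∈ Icc (0 : ℝ) 1, IntervalIntegrable u volume 0 c := fun c hc =>
    (intervalIntegrable_iff_integrableOn_Icc_of_le hc.1).2 (hu.mono_set (Icc_subset_Icc_right hc.2))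
  have ha_mem : a ∈ Icc (0 : ℝ) 1 := ⟨ha, hab.trans hb⟩
  have hb_mem : b ∈ Icc (0 : ℝ) 1 := ⟨ha.trans hab, hb⟩
  rw [hg b hb_mem, hg a ha_mem, intervalIntegral.integral_interval_sub_left (integrable b hb_mem)
    (integrable a ha_mem), intervalIntegral.integral_of_le hab]
  exact enorm_integral_le_lintegral_enorm _

end Primitive

lemma exists_continuous_of_ae_continuousOn {Ω F : Type*} [MeasurableSpace Ω] {P : Measure Ω}
    [Zero F] [TopologicalSpace F] [MeasurableSpace F] {ψ : ℝ → Ω → F}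
    (hψ : ∀ t ∈ Icc (0 : ℝ) 1, Measurable (ψ t))
    (hψ_cont : ∀ᵐ ω ∂P, ContinuousOn (fun t => ψ t ω) (Icc 0 1)) :
    ∃ φ : ℝ → Ω → F, (∀ ω, Continuous fun t => φ t ω) ∧ (∀ t, Measurable (φ t)) ∧
      ∀ᵐ ω ∂P, ∀ t ∈ Icc (0 : ℝ) 1, φ t ω = ψ t ω := by
  obtain ⟨A, hA, hA_meas, hA_cont⟩ := hψ_cont.exists_measurable_mem
  refine ⟨fun t => A.indicator (ψ (projIcc 0 1 zero_le_one t)), fun ω => ?_,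
    fun t => (hψ _ (Subtype.prop _)).indicator hA_meas, ?_⟩
  · by_cases hω : ω ∈ A
    · simp only [indicator_of_mem hω]
      exact (hA_cont ω hω).domRestrict.comp continuous_projIcc
    · simp only [indicator_of_notMem hω]
      exact continuous_const
  · filter_upwards [hA] with ω hω t ht
    rw [indicator_of_mem hω, projIcc_of_mem _ ht]

section Solution

variable {d : ℕ} {Ω : Type*} [mΩ : MeasurableSpace Ω] {P : Measure Ω} {ℱ : Filtration ℝ mΩ}
  {Y ψ : ℝ → Ω → E d} {x : E d} {f : ℝ → E d → E d}

lemma IsSolution.exists_controlledPath (hψ_sol : IsSolution P x f Y ψ)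
    (hY : Measurable fun z : ℝ × Ω => Y z.1 z.2) (hf : Measurable fun z : ℝ × E d => f z.1 z.2)
    (hψ : ∀ t ∈ Icc (0 : ℝ) 1, Measurable[ℱ t] (ψ t)) :
    ∃ φ : ℝ → Ω → E d, ControlledPath P ℱ φ (pathDensity (driftNorm x f) φ Y) ∧
      ∀ᵐ ω ∂P, ∀ t ∈ Icc (0 : ℝ) 1, φ t ω = ψ t ω := by
  obtain ⟨φ, φ_cont, φ_meas, φ_eq⟩ := exists_continuous_of_ae_continuousOn (P := P)
    (fun t ht => (hψ t ht).mono (ℱ.le t) le_rfl)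
    (hψ_sol.mono fun ω hω => continuousOn_of_eq_integral hω.1 hω.2)
  refine ⟨φ, ⟨φ_cont, φ_meas, fun t ht => ?_, ?_, ?_⟩, φ_eq⟩
  · exact ⟨ψ t, (hψ t ht).stronglyMeasurable, φ_eq.mono fun ω hω => hω t ht⟩
  · exact measurable_pathDensity (measurable_driftNorm x hf)
      (measurable_uncurry_of_continuous_of_measurable φ_cont φ_meas) hY
  · filter_upwards [hψ_sol, φ_eq] with ω hω hφψ a b ha hab hb
    rw [hφψ b ⟨ha.trans hab, hb⟩, hφψ a ⟨ha, hab.trans hb⟩]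
    refine (enorm_sub_le_of_eq_integral hω.1 hω.2 ha hab hb).trans_eq ?_
    refine setLIntegral_congr_fun measurableSet_Ioc fun r hr => ?_
    have hr' : r ∈ Icc (0 : ℝ) 1 := ⟨ha.trans hr.1.le, hr.2.trans hb⟩
    simp only [pathDensity, driftNorm_of_mem hr', hφψ r hr', ofReal_norm, add_assoc]

end Solution

/-! ### From moments to path estimates -/

lemma eLpNorm_le_of_lintegral_pow_le {Ω : Type*} [MeasurableSpace Ω] {P : Measure Ω}
    [IsProbabilityMeasure P] {m : ℝ} {n : ℕ} {N Z : ℝ≥0∞} {X : Ω → ℝ≥0∞}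
    (hX : AEMeasurable X P) (hmn : m ≤ n) (hn : n ≠ 0)
    (hXn : ∫⁻ ω, X ω ^ n ∂P ≤ N * Z ^ n) :
    eLpNorm X (ENNReal.ofReal m) P ≤ N ^ (1 / (n : ℝ)) * Z := by
  have pow_root : (Z ^ n) ^ (1 / (n : ℝ)) = Z := by
    rw [one_div, ENNReal.pow_rpow_inv_natCast hn]
  calc eLpNorm X (ENNReal.ofReal m) P ≤ eLpNorm X n P :=
        eLpNorm_le_eLpNorm_of_exponent_le (ENNReal.ofReal_le_of_le_toReal (by simpa using hmn))
          hX.aestronglyMeasurable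
    _ = (∫⁻ ω, X ω ^ n ∂P) ^ (1 / (n : ℝ)) := by
        rw [eLpNorm_eq_lintegral_rpow_enorm_toReal (by exact_mod_cast hn)
          (ENNReal.natCast_ne_top n)]
        simp
    _ ≤ (N * Z ^ n) ^ (1 / (n : ℝ)) := by gcongr
    _ = N ^ (1 / (n : ℝ)) * Z := by rw [ENNReal.mul_rpow_of_nonneg _ _ (by positivity), pow_root]

lemma eVariationOn_le_timeIntegral {Ω F : Type*} [SeminormedAddCommGroup F]
    {v : ℝ → Ω → ℝ≥0∞} {ω : Ω} {g : ℝ → F}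
    (hg : ∀ a b : ℝ, 0 ≤ a → a ≤ b → b ≤ 1 → ‖g b - g a‖ₑ ≤ timeIntegral v a b ω) {s t : ℝ}
    (hs : 0 ≤ s) (ht : t ≤ 1) : eVariationOn g (Icc s t) ≤ timeIntegral v s t ω := by
  refine iSup_le fun ⟨n, u, hu, hu_mem⟩ => ?_
  calc ∑ i ∈ Finset.range n, edist (g (u (i + 1))) (g (u i))
      ≤ ∑ i ∈ Finset.range n, timeIntegral v (u i) (u (i + 1)) ω := by
        refine Finset.sum_le_sum fun i _ => ?_
        rw [edist_eq_enorm_sub]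
        exact hg _ _ (hs.trans (hu_mem i).1) (hu i.le_succ) ((hu_mem (i + 1)).2.trans ht)
    _ = timeIntegral v (u 0) (u n) ω := sum_setLIntegral_Ioc _ hu n
    _ ≤ timeIntegral v s t ω := timeIntegral_mono v (hu_mem 0).1 (hu_mem n).2 ω

/-- The increments of the paths `ψ` over `[0,1]` are bounded by the time integrals of the density
`v`, whose moments over `[s,t]` are at most those of an exponential variable of mean
`G s t * (t - s) ^ e`. -/
structure IncrementDensity {d : ℕ} {Ω : Type*} [MeasurableSpace Ω] (P : Measure Ω)
    (ψ : ℝ → Ω → E d) (v : ℝ → Ω → ℝ≥0∞) (e : ℝ) (G : ℝ → ℝ → ℝ≥0∞) : Prop where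
  measurable : Measurable fun z : ℝ × Ω => v z.1 z.2
  apply_zero : ∀ᵐ ω ∂P, ψ 0 ω = 0
  enorm_sub_le : ∀ᵐ ω ∂P, ∀ a b : ℝ, 0 ≤ a → a ≤ b → b ≤ 1 →
    ‖ψ b ω - ψ a ω‖ₑ ≤ timeIntegral v a b ω
  lintegral_pow_le : ∀ n : ℕ, ∀ s t : ℝ, 0 ≤ s → s ≤ t → t ≤ 1 →
    ∫⁻ ω, timeIntegral v s t ω ^ n ∂P ≤ n.factorial * (G s t * ENNReal.ofReal ((t - s) ^ e)) ^ n

lemma RegularizingNoise.exists_incrementDensity {d : ℕ} {Ω : Type*} [mΩ : MeasurableSpace Ω]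
    {P : Measure Ω} [IsProbabilityMeasure P] {ℱ : Filtration ℝ mΩ} {H p q θ e M : ℝ} {K : ℝ → ℝ≥0}
    {Y ψ : ℝ → Ω → E d} {x : E d} {f : ℝ → E d → E d} (hN : RegularizingNoise P ℱ H K Y)
    (hθ : AdmissibleExponent d H p q θ) (he₀ : 0 ≤ e) (he : e ≤ 1 - 1 / q - (d / p + θ) * H)
    (hf : Measurable fun z : ℝ × E d => f z.1 z.2)
    (hf_le : ∀ r ∈ Icc (0 : ℝ) 1, ∀ y, ‖f r y‖ ≤ M)
    (hψ : ∀ t ∈ Icc (0 : ℝ) 1, Measurable[ℱ t] (ψ t)) (hψ_sol : IsSolution P x f Y ψ) :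
    ∃ v : ℝ → Ω → ℝ≥0∞, IncrementDensity P ψ v e fun s t =>
      momentConst d K H p q θ * (mixedNorm p q s t f + mixedNorm p q s t f ^ q) := by
  obtain ⟨φ, hφ, φ_eq⟩ := hψ_sol.exists_controlledPath hN.measurable hf hψ
  refine ⟨_, hφ.measurable_density, ?_, ?_, fun n s t hs hst ht => ?_⟩
  · filter_upwards [hψ_sol] with ω hω
    rw [hω.2 0 ⟨le_rfl, zero_le_one⟩, intervalIntegral.integral_same]
  · filter_upwards [hφ.enorm_sub_le, φ_eq] with ω hω hφψ a b ha hab hb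
    rw [← hφψ b ⟨ha.trans hab, hb⟩, ← hφψ a ⟨ha, hab.trans hb⟩]
    exact hω a b ha hab hb
  · rw [← scalarMixedNorm_driftNorm x hf p q hs ht]
    exact hN.lintegral_timeIntegral_pow_le hθ he₀ he hφ (measurable_driftNorm x hf)
      (driftNorm_mem_Icc hf_le) hs hst ht n

/-- The constant in the tail bound for the Hölder norm of exponent `e / 2`; the inverse is the sum
of the geometric series over the dyadic levels. -/
def tailConst (e : ℝ) (n : ℕ) : ℝ≥0∞ :=
  5 * (n.factorial * (1 - ENNReal.ofReal (2 ^ (1 + n * (e / 2 - e))))⁻¹) ^ (1 / (n : ℝ))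

lemma tailConst_ne_top {e : ℝ} {n : ℕ} (he : 0 < e) (hen : 2 / e < n) : tailConst e n ≠ ∞ := by
  have series_ne_top : (1 - ENNReal.ofReal (2 ^ (1 + n * (e / 2 - e))))⁻¹ ≠ ∞ :=
    inv_one_sub_ofReal_two_rpow_ne_top (by linarith [(div_lt_iff₀ he).1 hen])
  unfold tailConst
  finiteness

namespace IncrementDensity

variable {d : ℕ} {Ω : Type*} [MeasurableSpace Ω] {P : Measure Ω}
  {ψ : ℝ → Ω → E d} {v : ℝ → Ω → ℝ≥0∞} {e m : ℝ} {G : ℝ → ℝ → ℝ≥0∞} {n : ℕ}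

lemma lintegral_holderMajorant_le (hv : IncrementDensity P ψ v e G) {Z : ℝ≥0∞}
    (hG : ∀ s t : ℝ, 0 ≤ s → t ≤ 1 → G s t ≤ Z) (hn : n ≠ 0) :
    ∫⁻ ω, (5 * holderMajorant v (e / 2) n ω ^ (1 / (n : ℝ))) ^ n ∂P ≤ (tailConst e n * Z) ^ n := by
  have moment_le (s t : ℝ) (hs : 0 ≤ s) (hst : s ≤ t) (ht : t ≤ 1) :
      ∫⁻ ω, timeIntegral v s t ω ^ n ∂P ≤
        n.factorial * Z ^ n * ENNReal.ofReal ((t - s) ^ e) ^ n := by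
    refine (hv.lintegral_pow_le n s t hs hst ht).trans ?_
    rw [mul_assoc, ← mul_pow]
    gcongr
    exact hG s t hs ht
  simp only [tailConst, mul_pow, one_div, ENNReal.rpow_inv_natCast_pow hn]
  rw [lintegral_const_mul _ (measurable_holderMajorant hv.measurable _ n)]
  refine (mul_le_mul_right
    (SingularDrift.lintegral_holderMajorant_le hv.measurable moment_le) _).trans_eq ?_
  ring

variable [IsProbabilityMeasure P]

lemma eLpNorm_eVariationOn_le (hv : IncrementDensity P ψ v e G) (hmn : m ≤ n) (hn : n ≠ 0)
    {s t : ℝ} (hs : 0 ≤ s) (hst : s ≤ t) (ht : t ≤ 1) :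
    eLpNorm (fun ω => eVariationOn (fun r => ψ r ω) (Icc s t)) (ENNReal.ofReal m) P ≤
      n.factorial ^ (1 / (n : ℝ)) * (G s t * ENNReal.ofReal ((t - s) ^ e)) := by
  refine (eLpNorm_mono_enorm_ae (g := timeIntegral v s t) ?_).trans
    (eLpNorm_le_of_lintegral_pow_le (measurable_timeIntegral hv.measurable s t).aemeasurable hmn hn
      (hv.lintegral_pow_le n s t hs hst ht))
  filter_upwards [hv.enorm_sub_le] with ω hω
  exact eVariationOn_le_timeIntegral hω hs ht

lemma measure_le_holderNorm_le (hv : IncrementDensity P ψ v e G) {Z : ℝ≥0∞}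
    (hG : ∀ s t : ℝ, 0 ≤ s → t ≤ 1 → G s t ≤ Z) (he₀ : 0 ≤ e) (he₁ : e ≤ 1) (hm : 0 < m)
    (hmn : m ≤ n) {r : ℝ} (hr : 0 < r) :
    P {ω | ENNReal.ofReal r ≤ holderNorm (e / 2) fun t => ψ t ω} ≤
      (tailConst e n * Z) ^ m * ENNReal.ofReal (r ^ (-m)) := by
  have hn : n ≠ 0 := by exact_mod_cast (hm.trans_le hmn).ne'
  set X : Ω → ℝ≥0∞ := fun ω => 5 * holderMajorant v (e / 2) n ω ^ (1 / (n : ℝ))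
  have X_meas : Measurable X :=
    ((measurable_holderMajorant hv.measurable _ n).pow_const _).const_mul 5
  have majorized : ∀ᵐ ω ∂P, holderNorm (e / 2) (fun t => ψ t ω) ≤ X ω := by
    filter_upwards [hv.apply_zero, hv.enorm_sub_le] with ω hω₀ hω
    exact holderNorm_le hω₀ hω (by linarith) (by linarith) hn
  have X_norm_le : eLpNorm X (ENNReal.ofReal m) P ≤ tailConst e n * Z := by
    simpa using eLpNorm_le_of_lintegral_pow_le (N := 1) X_meas.aemeasurable hmn hn
      (by simpa only [one_mul] using hv.lintegral_holderMajorant_le hG hn)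
  calc P {ω | ENNReal.ofReal r ≤ holderNorm (e / 2) fun t => ψ t ω}
      ≤ P {ω | ENNReal.ofReal r ≤ ‖X ω‖ₑ} :=
        measure_mono_ae (majorized.mono fun ω hω hr_le => le_trans hr_le hω)
    _ ≤ (ENNReal.ofReal r)⁻¹ ^ m * eLpNorm X (ENNReal.ofReal m) P ^ m := by
        simpa only [ENNReal.toReal_ofReal hm.le] using meas_ge_le_mul_pow_eLpNorm_enorm P
          (ENNReal.ofReal_pos.2 hm).ne' ENNReal.ofReal_ne_top X_meas.aestronglyMeasurable
          (ENNReal.ofReal_pos.2 hr).ne' (fun h => absurd h ENNReal.ofReal_ne_top)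
    _ ≤ (ENNReal.ofReal r)⁻¹ ^ m * (tailConst e n * Z) ^ m := by gcongr
    _ = _ := by
        rw [← ENNReal.ofReal_inv_of_pos hr,
          ENNReal.ofReal_rpow_of_nonneg (inv_nonneg.2 hr.le) hm.le, Real.inv_rpow hr.le,
          ← Real.rpow_neg hr.le, mul_comm]

end IncrementDensity

lemma exists_admissibleExponent {d : ℕ} {H p q : ℝ} (hd : 1 ≤ d) (hH₀ : 0 < H) (hH₁ : H < 1)
    (hp : 1 ≤ p) (hq : 1 ≤ q) (hHpq : (1 - H) / q + H * d / p < 1 - H) :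
    ∃ θ, AdmissibleExponent d H p q θ ∧
      1 - H - H * d / p - (1 - H) / q ≤ 1 - 1 / q - (d / p + θ) * H := by
  have h1H : 0 < 1 - H := sub_pos.2 hH₁
  have div_q : (1 - H) / q = (1 - H) * (1 / q) := by ring
  have div_p : H * d / p = d / p * H := by ring
  have div_p_pos : 0 < d / p * H := by positivity
  set θ₀ := d / p * H / (1 - H)
  have hθ₀ : θ₀ * (1 - H) = d / p * H := div_mul_cancel₀ _ h1H.ne'
  have θ₀_pos : 0 < θ₀ := by positivity
  have θ₀_lt : θ₀ < 1 - 1 / q := (div_lt_iff₀ h1H).2 (by linarith)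
  have one_lt_q : 1 < q := hq.lt_of_ne' (by rintro rfl; norm_num at θ₀_lt; linarith)
  set θ := (θ₀ + (1 - 1 / q)) / 2
  have hθ₀θ : θ₀ < θ := left_lt_add_div_two.2 θ₀_lt
  have hθ_lt : θ < 1 - 1 / q := add_div_two_lt_right.2 θ₀_lt
  refine ⟨θ, ⟨hd, hp, one_lt_q, hH₀.le, (θ₀_pos.trans hθ₀θ).le, hθ_lt, ?_⟩, ?_⟩
  · have := mul_lt_mul_of_pos_right hθ₀θ h1H
    linarith
  · have := mul_le_mul_of_nonneg_right hθ_lt.le hH₀.le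
    linarith

lemma exists_pos_le_ofReal {a b : ℝ≥0∞} (ha : a ≠ ∞) (hb : b ≠ ∞) :
    ∃ C : ℝ, 0 < C ∧ a ≤ ENNReal.ofReal C ∧ b ≤ ENNReal.ofReal C := by
  have le_of {c : ℝ≥0∞} (hc : c ≤ a + b) : c ≤ ENNReal.ofReal ((a + b).toReal + 1) :=
    hc.trans (ENNReal.le_ofReal_iff_toReal_le (by finiteness) (by positivity) |>.2 (by linarith))
  exact ⟨(a + b).toReal + 1, by positivity, le_of le_self_add, le_of le_add_self⟩

lemma add_rpow_le_two_mul (G : ℝ≥0∞) {q : ℝ} (hq : 1 ≤ q) : G + G ^ q ≤ 2 * (1 + G ^ q) := by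
  have le_add : G ≤ 1 + G ^ q := by
    rcases le_total G 1 with h | h
    · exact le_add_right h
    · exact le_add_left (ENNReal.le_rpow_self_of_one_le h hq)
  calc G + G ^ q ≤ (1 + G ^ q) + (1 + G ^ q) := add_le_add le_add le_add_self
    _ = _ := (two_mul _).symm

lemma mixedNorm_add_rpow_le {d : ℕ} {p q s t : ℝ} (hq : 1 ≤ q) (f : ℝ → E d → E d) (hs : 0 ≤ s)
    (ht : t ≤ 1) :
    mixedNorm p q s t f + mixedNorm p q s t f ^ q ≤ 2 * (1 + mixedNorm p q 0 1 f ^ q) := by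
  refine (add_rpow_le_two_mul _ hq).trans ?_
  unfold mixedNorm
  gcongr

end SingularDrift

end

theorem corollary3p10_general {d : ℕ} (hd : 1 ≤ d) (H : ℝ) (hH0 : 0 < H) (hH1 : H < 1)
    (p q : ℝ) (hp : 1 ≤ p) (hq : 1 ≤ q) (hmain : (1 - H) / q + H * d / p < 1 - H)
    (m : ℝ) (hm : 0 < m) (K : ℝ → ℝ≥0) :
    ∃ C : ℝ, 0 < C ∧ ∃ γ : ℝ, 0 < γ ∧ γ < 1 ∧
      ∀ (Ω : Type*) [mΩ : MeasurableSpace Ω] (P : Measure Ω) [IsProbabilityMeasure P]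
        (ℱ : Filtration ℝ mΩ) (Y : ℝ → Ω → SingularDrift.E d),
        SingularDrift.RegularizingNoise P ℱ H K Y →
      ∀ (x : SingularDrift.E d) (f : ℝ → SingularDrift.E d → SingularDrift.E d),
        Measurable (fun z : ℝ × SingularDrift.E d => f z.1 z.2) →
        (∃ M : ℝ, ∀ r ∈ Set.Icc (0 : ℝ) 1, ∀ y, ‖f r y‖ ≤ M) →
      ∀ ψ : ℝ → Ω → SingularDrift.E d,
        (∀ t ∈ Set.Icc (0 : ℝ) 1, Measurable[ℱ t] (ψ t)) →
        SingularDrift.IsSolution P x f Y ψ →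
        (∀ s t : ℝ, 0 ≤ s → s ≤ t → t ≤ 1 →
          eLpNorm (fun ω => eVariationOn (fun r => ψ r ω) (Set.Icc s t)) (ENNReal.ofReal m) P ≤
            ENNReal.ofReal C *
              (SingularDrift.mixedNorm p q s t f + SingularDrift.mixedNorm p q s t f ^ q) *
              ENNReal.ofReal ((t - s) ^ (1 - H - H * d / p - (1 - H) / q))) ∧
        (∀ r : ℝ, 0 < r →
          P {ω | ENNReal.ofReal r ≤ SingularDrift.holderNorm γ (fun t => ψ t ω)} ≤
            ENNReal.ofReal C * (1 + SingularDrift.mixedNorm p q 0 1 f ^ q) ^ m *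
              ENNReal.ofReal (r ^ (-m))) := by
  obtain ⟨θ, hθ, he⟩ := SingularDrift.exists_admissibleExponent hd hH0 hH1 hp hq hmain
  set e := 1 - H - H * d / p - (1 - H) / q
  have he₀ : 0 < e := by linarith
  have he₁ : e < 1 := by
    have : 0 < (1 - H) / q := div_pos (sub_pos.2 hH1) (by linarith)
    have : 0 ≤ H * d / p := by positivity
    linarith
  obtain ⟨n, hn⟩ := exists_nat_gt (max m (2 / e))
  obtain ⟨hmn, hen⟩ := max_lt_iff.1 hn
  have n_ne_zero : n ≠ 0 := by exact_mod_cast (hm.trans hmn).ne'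
  have D_ne_top := SingularDrift.momentConst_ne_top (K := K) hθ
  have T_ne_top := SingularDrift.tailConst_ne_top he₀ hen
  set D := SingularDrift.momentConst d K H p q θ
  set T := SingularDrift.tailConst e n
  obtain ⟨C, C_pos, variation_le, tail_le⟩ := SingularDrift.exists_pos_le_ofReal
    (a := n.factorial ^ (1 / (n : ℝ)) * D) (b := (T * (D * 2)) ^ m) (by finiteness) (by finiteness)
  refine ⟨C, C_pos, e / 2, half_pos he₀, by linarith, ?_⟩
  intro Ω _ P _ ℱ Y hN x f hf ⟨M, hM⟩ ψ hψ hψ_sol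
  obtain ⟨v, hv⟩ := hN.exists_incrementDensity hθ he₀.le he hf hM hψ hψ_sol
  refine ⟨fun s t hs hst ht => ?_, fun r hr => ?_⟩
  · refine (hv.eLpNorm_eVariationOn_le hmn.le n_ne_zero hs hst ht).trans ?_
    rw [← mul_assoc, ← mul_assoc]
    gcongr
  · refine (hv.measure_le_holderNorm_le (fun s t hs ht => mul_le_mul_right
      (SingularDrift.mixedNorm_add_rpow_le hq f hs ht) D) he₀.le he₁.le hm hmn.le hr).trans ?_
    rw [← mul_assoc D, ← mul_assoc T, ENNReal.mul_rpow_of_nonneg _ _ hm.le]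
    gcongr

theorem corollary3p10 {d : ℕ} (hd : 1 ≤ d) (H : ℝ) (hH0 : 0 < H) (hH1 : H < 1)
    (p q : ℝ) (hp : 1 ≤ p) (hq : 1 ≤ q) (hmain : (1 - H) / q + H * d / p < 1 - H)
    (m : ℝ) (hm : 2 ≤ m) (κ : ℝ≥0) (K : ℝ → ℝ≥0∞ → ℝ≥0) :
    ∃ C : ℝ, 0 < C ∧ ∃ γ : ℝ, 0 < γ ∧ γ < 1 ∧
      ∀ (Ω : Type*) [mΩ : MeasurableSpace Ω] (P : Measure Ω) [IsProbabilityMeasure P]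
        (ℱ : Filtration ℝ mΩ) (Y : ℝ → Ω → SingularDrift.E d),
        Measurable (fun z : ℝ × Ω => Y z.1 z.2) →
        (∀ t ∈ Set.Icc (0 : ℝ) 1, Measurable[ℱ t] (Y t)) →
        (∀ t ∈ Set.Icc (0 : ℝ) 1, Integrable (Y t) P) →
        SingularDrift.NoiseAssumption P ℱ H κ K Y →
      ∀ (x : SingularDrift.E d) (f : ℝ → SingularDrift.E d → SingularDrift.E d),
        Measurable (fun z : ℝ × SingularDrift.E d => f z.1 z.2) →
        (∃ M : ℝ, ∀ r ∈ Set.Icc (0 : ℝ) 1, ∀ y, ‖f r y‖ ≤ M) →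
        SingularDrift.mixedNorm p q 0 1 f < ∞ →
      ∀ ψ : ℝ → Ω → SingularDrift.E d,
        (∀ t ∈ Set.Icc (0 : ℝ) 1, Measurable[ℱ t] (ψ t)) →
        SingularDrift.IsSolution P x f Y ψ →
        (∀ s t : ℝ, 0 ≤ s → s ≤ t → t ≤ 1 →
          eLpNorm (fun ω => eVariationOn (fun r => ψ r ω) (Set.Icc s t)) (ENNReal.ofReal m) P ≤
            ENNReal.ofReal C *
              (SingularDrift.mixedNorm p q s t f + SingularDrift.mixedNorm p q s t f ^ q) *
              ENNReal.ofReal ((t - s) ^ (1 - H - H * d / p - (1 - H) / q))) ∧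
        (∀ r : ℝ, 0 < r →
          P {ω | ENNReal.ofReal r ≤ SingularDrift.holderNorm γ (fun t => ψ t ω)} ≤
            ENNReal.ofReal C * (1 + SingularDrift.mixedNorm p q 0 1 f ^ q) ^ m *
              ENNReal.ofReal (r ^ (-m))) := by
  obtain ⟨C, C_pos, γ, γ_pos, γ_lt_one, estimates⟩ := corollary3p10_general hd H hH0 hH1 p q hp hq
    hmain m (by linarith) fun β => K β ∞
  exact ⟨C, C_pos, γ, γ_pos, γ_lt_one, fun Ω _ P _ ℱ Y hY hYa hYi hN x f hf hM _ =>
    estimates Ω P ℱ Y (hN.regularizingNoise hY hYa hYi) x f hf hM⟩
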